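/- A linear pencil is an operator function $A(z)=A_0+zA_1$ with bounded coefficients $A_0,A_1$; on a complex Hilbert space it is contractive (resp. unitary) if $A(\lambda)$ is a contraction (resp. unitary) for every $\lambda\in\mathbb T=\{|\lambda|=1\}$. If $\mathcal H\subset\widetilde{\mathcal H}$, a pencil $\widetilde T$ on $\widetilde{\mathcal H}$ is a dilation of a pencil $T$ on $\mathcal H$ if $T(\lambda)^n=P_{\mathcal H}\widetilde T(\lambda)^n|\mathcal H$ for all $\lambda\in\mathbb T$, $n\ge 0$; it is uniform if moreover $T_{j_1}\cdots T_{j_n}=P_{\mathcal H}\widetilde T_{j_1}\cdots\widetilde T_{j_n}|\mathcal H$ for all $n$ and $j_1,\dots,j_n\in\{0,1\}$. A unitary dilation of a contractive pencil is a dilation that is a unitary pencil. A minimal (uniform) unitary dilation of $T$ is a minimal element among all (uniform) unitary dilations of $T$ for the order in which $T'\le\widetilde T$ means that $T'$ acts on a closed subspace $\mathcal H'$ with $\mathcal H\subset\mathcal H'\subset\widetilde{\mathcal H}$ and $\widetilde T$ is a dilation of $T'$. For a Hilbert space $\mathcal X$, $H^2_{\mathcal X}(\mathbb D)$ is the space of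 holomorphic $x:\mathbb D\to\mathcal X$ with $\|x\|^2=\frac1{2\pi}\sup_{0<r<1}\int_0^{2\pi}\|x(re^{is})\|^2ds<\infty$; a contractive holomorphic function $\theta:\mathbb D\to[\mathcal X,\mathcal Y]$ is outer if $\theta H^2_{\mathcal X}(\mathbb D)$ is dense in $H^2_{\mathcal Y}(\mathbb D)$. **Theorem.** Let $T(\lambda)=T_0+\lambda T_1$ be a contractive linear pencil on a separable complex Hilbert space $\mathcal H$. (a) There are a separable Hilbert space $\mathcal Y$ and a linear outer function $F(z)=F_0+zF_1$ with values in $[\mathcal H,\mathcal Y]$ such that $F(\lambda)^*F(\lambda)=I-T(\lambda)^*T(\lambda)$ for all $\lambda\in\mathbb T$. (b) Let $\mathcal Y$, $F$ be any such pair. On $\mathcal K_+=\big(\bigoplus_{-\infty}^{-1}\mathcal Y\big)\oplus\mathcal H$ let $V(\lambda)=V_0+\lambda V_1$ be the pencil sending the column $(\dots,y_{-2},y_{-1},h)$ to $(\dots,y_{-2},y_{-1},F(\lambda)h,T(\lambda)h)$. Put $\mathcal V=\bigvee_{\lambda\in\mathbb T}V(\lambda)\mathcal K_+$, $\mathcal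 L=\mathcal K_+\ominus\mathcal V$, $\mathcal K_1=\mathcal V\ominus V(1)\mathcal K_+$, $P(\lambda)=P_{\overline{V_0\mathcal K_+}}+\lambda P_{\overline{V_1\mathcal K_+}}$, $\mathcal U=\mathcal K_1\oplus\mathcal L$, and let $Q(\lambda):\mathcal U\to\mathcal K_+$, $Q(\lambda)(k\oplus l)=P(\lambda)k+l$. On $$\mathcal K=\Big(\bigoplus_{-\infty}^{-1}\mathcal Y\Big)\oplus\mathcal H\oplus\Big(\bigoplus_{1}^{\infty}\mathcal U\Big)$$ let $U(\lambda)$ be the linear pencil sending $(\dots,y_{-2},y_{-1},\boxed{h},u_1,u_2,\dots)$ to $$\big(\dots,y_{-2},y_{-1},\,F(\lambda)h+P_{\mathcal Y}Q(\lambda)u_1,\,\boxed{T(\lambda)h+P_{\mathcal H}Q(\lambda)u_1},\,u_2,u_3,\dots\big),$$ where the box marks the $\mathcal H$-component and $P_{\mathcal Y}$, $P_{\mathcal H}$ are the projections of $\mathcal K_+$ onto its $(-1)$-st copy of $\mathcal Y$ and onto $\mathcal H$. Then, with $\mathcal H$ embedded in $\mathcal K$ as the $\mathcal H$-component, $U(\lambda)$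 is a minimal unitary dilation of $T(\lambda)$, and it is moreover a minimal uniform unitary dilation of $T(\lambda)$. -/

import Mathlib

open scoped ENNReal InnerProductSpace

universe u v w

noncomputable section

namespace PencilDilation

/-! ## Linear pencils and their dilations -/

/-- A linear pencil `A(z) = A₀ + z A₁` of bounded operators from `E` to `F`,
given by its two coefficients. -/
structure LinearPencil (E : Type u) (F : Type v)
    [NormedAddCommGroup E] [InnerProductSpace ℂ E]
    [NormedAddCommGroup F] [InnerProductSpace ℂ F] where
  coeff : Fin 2 → E →L[ℂ] F

namespace LinearPencil

variable {E : Type u} {F : Type v} [NormedAddCommGroup E] [InnerProductSpace ℂ E]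
  [NormedAddCommGroup F] [InnerProductSpace ℂ F]

/-- The value `A(z) = A₀ + z A₁`. -/
def eval (A : LinearPencil E F) (z : ℂ) : E →L[ℂ] F :=
  A.coeff 0 + z • A.coeff 1

/-- `A(ζ)` is a contraction for every `ζ` on the unit circle. -/
def IsContractive (A : LinearPencil E F) : Prop :=
  ∀ ζ : Circle, ‖A.eval ζ‖ ≤ 1

/-- `A(ζ)` is a unitary operator for every `ζ` on the unit circle. -/
def IsUnitary [CompleteSpace E] (A : LinearPencil E E) : Prop :=
  ∀ ζ : Circle, A.eval ζ ∈ unitary (E →L[ℂ] E)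

end LinearPencil

section Dilation

variable {H : Type u} {K : Type v} [NormedAddCommGroup H] [InnerProductSpace ℂ H] [CompleteSpace H]
  [NormedAddCommGroup K] [InnerProductSpace ℂ K] [CompleteSpace K]

/-- The compression `P_H A|H` of an operator `A` on `K`, where `H` is regarded as a subspace of `K`
through the isometric embedding `ι`. The adjoint of `ι` is the orthogonal projection onto `ι(H)`
followed by the identification of `ι(H)` with `H`. -/
def compression (ι : H →ₗᵢ[ℂ] K) (A : K →L[ℂ] K) : H →L[ℂ] H :=
  (ContinuousLinearMap.adjoint ι.toContinuousLinearMap) ∘L A ∘L ι.toContinuousLinearMap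

/-- `T'` (on `K ⊇ H`) is a dilation of `T` (on `H`):
`T(ζ)ⁿ = P_H T'(ζ)ⁿ|H` for all unimodular `ζ` and all `n ≥ 0`. -/
def IsDilation (ι : H →ₗᵢ[ℂ] K) (T : LinearPencil H H) (T' : LinearPencil K K) : Prop :=
  ∀ (ζ : Circle) (n : ℕ), T.eval ζ ^ n = compression ι (T'.eval ζ ^ n)

/-- The dilation `T'` of `T` is uniform:
`T_{j₁} ⋯ T_{jₙ} = P_H T'_{j₁} ⋯ T'_{jₙ}|H` for all words in the coefficients. -/
def IsUniformDilation (ι : H →ₗᵢ[ℂ] K) (T : LinearPencil H H) (T' : LinearPencil K K) : Prop :=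
  IsDilation ι T T' ∧
    ∀ j : List (Fin 2), (j.map T.coeff).prod = compression ι (j.map T'.coeff).prod

/-- `T'` is a unitary dilation of the contractive pencil `T`. -/
def IsUnitaryDilation (ι : H →ₗᵢ[ℂ] K) (T : LinearPencil H H) (T' : LinearPencil K K) : Prop :=
  T.IsContractive ∧ T'.IsUnitary ∧ IsDilation ι T T'

/-- `T'` is a uniform unitary dilation of the contractive pencil `T`. -/
def IsUniformUnitaryDilation (ι : H →ₗᵢ[ℂ] K) (T : LinearPencil H H)
    (T' : LinearPencil K K) : Prop :=
  T.IsContractive ∧ T'.IsUnitary ∧ IsUniformDilation ι T T'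

/-- The embedding of `H` into a subspace `M` of `K` that contains `H`. -/
def embedInto (ι : H →ₗᵢ[ℂ] K) (M : Submodule ℂ K) (hM : ∀ h, ι h ∈ M) : H →ₗᵢ[ℂ] M where
  toLinearMap := ι.toLinearMap.codRestrict M hM
  norm_map' h := ι.norm_map h

/-- `T'` is a minimal element among all unitary dilations of `T`, for the order in which `T'' ≤ T'`
means that `T''` acts on a closed subspace `M` with `H ⊆ M ⊆ K` and `T'` is a dilation of `T''`. -/
def IsMinimalUnitaryDilation (ι : H →ₗᵢ[ℂ] K) (T : LinearPencil H H)
    (T' : LinearPencil K K) : Prop :=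
  IsUnitaryDilation ι T T' ∧
    ∀ (M : Submodule ℂ K) [CompleteSpace M] (hM : ∀ h, ι h ∈ M) (T'' : LinearPencil M M),
      IsUnitaryDilation (embedInto ι M hM) T T'' → IsDilation M.subtypeₗᵢ T'' T' → M = ⊤

/-- `T'` is a minimal element, for the same order, among all uniform unitary dilations of `T`. -/
def IsMinimalUniformUnitaryDilation (ι : H →ₗᵢ[ℂ] K) (T : LinearPencil H H)
    (T' : LinearPencil K K) : Prop :=
  IsUniformUnitaryDilation ι T T' ∧
    ∀ (M : Submodule ℂ K) [CompleteSpace M] (hM : ∀ h, ι h ∈ M) (T'' : LinearPencil M M),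
      IsUniformUnitaryDilation (embedInto ι M hM) T T'' → IsDilation M.subtypeₗᵢ T'' T' → M = ⊤

end Dilation

/-! ## Hardy spaces and outer factors -/

section Hardy

variable {X : Type u} {Y : Type v} [NormedAddCommGroup X] [InnerProductSpace ℂ X]
  [NormedAddCommGroup Y] [InnerProductSpace ℂ Y]

/-- The Hardy norm: `‖x‖² = (2π)⁻¹ sup_{0<r<1} ∫₀^{2π} ‖x(r e^{is})‖² ds`, with values in `[0, ∞]`.
Only the values of `x` in the open unit disk matter. -/
def hardyNorm (x : ℂ → X) : ℝ≥0∞ :=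
  ((ENNReal.ofReal (2 * Real.pi))⁻¹ * ⨆ r ∈ Set.Ioo (0 : ℝ) 1,
    ∫⁻ s in Set.Icc (0 : ℝ) (2 * Real.pi), ‖x (r * Complex.exp (s * Complex.I))‖ₑ ^ 2)
      ^ (1 / 2 : ℝ)

/-- Membership in the Hardy space `H²_X(𝔻)`. -/
def MemHardy (x : ℂ → X) : Prop :=
  DifferentiableOn ℂ x (Metric.ball 0 1) ∧ hardyNorm x < ∞

/-- A contractive holomorphic function `θ : 𝔻 → [X, Y]` is outer if `θ H²_X(𝔻)` is dense in
`H²_Y(𝔻)`. -/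
def IsOuter (θ : ℂ → X →L[ℂ] Y) : Prop :=
  DifferentiableOn ℂ θ (Metric.ball 0 1) ∧
  (∀ z ∈ Metric.ball (0 : ℂ) 1, ‖θ z‖ ≤ 1) ∧
  ∀ y : ℂ → Y, MemHardy y → ∀ ε : ℝ≥0∞, 0 < ε →
    ∃ x : ℂ → X, MemHardy x ∧ hardyNorm (fun z => y z - θ z (x z)) < ε

/-- `F` is a linear outer function with `F(ζ)* F(ζ) = I - T(ζ)* T(ζ)` on the unit circle. -/
def IsOuterFactor [CompleteSpace X] [CompleteSpace Y] (T : LinearPencil X X)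
    (F : LinearPencil X Y) : Prop :=
  IsOuter F.eval ∧ ∀ ζ : Circle,
    ContinuousLinearMap.adjoint (F.eval ζ) ∘L F.eval ζ =
      ContinuousLinearMap.id ℂ X - ContinuousLinearMap.adjoint (T.eval ζ) ∘L T.eval ζ

end Hardy

/-! ## One-sided infinite orthogonal sums -/

/-- The orthogonal sum of countably many copies `X₀ ⊕ X₁ ⊕ ⋯` of `X`. -/
abbrev SeqSum (X : Type u) [NormedAddCommGroup X] [InnerProductSpace ℂ X] : Type u :=
  lp (fun _ : ℕ => X) 2

section Shifts

variable {X : Type u} [NormedAddCommGroup X] [InnerProductSpace ℂ X]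

theorem summable_sq (x : SeqSum X) : Summable fun n => ‖x n‖ ^ 2 := by
  have h := (lp.memℓp x).summable (by norm_num)
  simpa using h

theorem memlp_of_summable_sq {X : Type u} [NormedAddCommGroup X] {f : ℕ → X} (h : Summable fun n => ‖f n‖ ^ 2) :
    Memℓp f 2 := by
  rw [memℓp_gen_iff (by norm_num)]
  simpa using h

theorem norm_sq_tsum (x : SeqSum X) : ‖x‖ ^ 2 = ∑' n, ‖x n‖ ^ 2 := by
  have h := lp.norm_rpow_eq_tsum (p := 2) (by norm_num) x
  simpa using h

/-- The forward shift `(x₀, x₁, …) ↦ (0, x₀, x₁, …)`. -/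
def shiftForward (X : Type u) [NormedAddCommGroup X] [InnerProductSpace ℂ X] :
    SeqSum X →L[ℂ] SeqSum X :=
  LinearMap.mkContinuous
    { toFun := fun x => ⟨fun n => Nat.casesOn n 0 fun m => x m, memlp_of_summable_sq (by
        rw [← summable_nat_add_iff 1]
        exact summable_sq x)⟩
      map_add' := fun x y => by
        ext n
        cases n with
        | zero => exact (add_zero (0 : X)).symm
        | succ m => rfl
      map_smul' := fun c x => by
        ext n
        cases n <;> simp } 1 (fun x => by
      rw [one_mul]
      refine le_of_sq_le_sq ?_ (norm_nonneg _)
      rw [norm_sq_tsum, norm_sq_tsum, Summable.tsum_eq_zero_add]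
      · simp
      · rw [← summable_nat_add_iff 1]
        exact summable_sq x)

/-- The backward shift `(x₀, x₁, …) ↦ (x₁, x₂, …)`. -/
def shiftBackward (X : Type u) [NormedAddCommGroup X] [InnerProductSpace ℂ X] :
    SeqSum X →L[ℂ] SeqSum X :=
  LinearMap.mkContinuous
    { toFun := fun x => ⟨fun n => x (n + 1), memlp_of_summable_sq
        ((summable_nat_add_iff 1).2 (summable_sq x))⟩
      map_add' := fun x y => by
        ext n
        rfl
      map_smul' := fun c x => by
        ext n
        simp } 1 (fun x => by
      rw [one_mul]
      refine le_of_sq_le_sq ?_ (norm_nonneg _)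
      rw [norm_sq_tsum, norm_sq_tsum, (summable_sq x).tsum_eq_zero_add]
      exact le_add_of_nonneg_left (by positivity))

/-- The inclusion `x ↦ (x, 0, 0, …)` of the summand of index `0`. -/
def inclZero (X : Type u) [NormedAddCommGroup X] [InnerProductSpace ℂ X] : X →L[ℂ] SeqSum X :=
  lp.singleContinuousLinearMap ℂ (fun _ : ℕ => X) 2 0

/-- The projection `(x₀, x₁, …) ↦ x₀` onto the summand of index `0`. -/
def projZero (X : Type u) [NormedAddCommGroup X] [InnerProductSpace ℂ X] : SeqSum X →L[ℂ] X :=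
  lp.evalCLM ℂ (fun _ : ℕ => X) 2 0

@[simp] theorem shiftForward_zero (x : SeqSum X) : shiftForward X x 0 = 0 := rfl
@[simp] theorem shiftForward_succ (x : SeqSum X) (n : ℕ) : shiftForward X x (n + 1) = x n := rfl
@[simp] theorem shiftBackward_apply (x : SeqSum X) (n : ℕ) : shiftBackward X x n = x (n + 1) := rfl
@[simp] theorem projZero_apply (x : SeqSum X) : projZero X x = x 0 := rfl
@[simp] theorem inclZero_zero (x : X) : inclZero X x 0 = x := by simp [inclZero]
@[simp] theorem inclZero_succ (x : X) (n : ℕ) : inclZero X x (n + 1) = 0 := by simp [inclZero]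

end Shifts

/-! ## The isometric dilation -/

section IsometricDilation

variable {H : Type u} {Y : Type v} [NormedAddCommGroup H] [InnerProductSpace ℂ H]
  [NormedAddCommGroup Y] [InnerProductSpace ℂ Y]

/-- `K₊ = (⨁_{-∞}^{-1} Y) ⊕ H`. The entry of index `n : ℕ` of the first component is the one at
position `-(n+1)`. -/
abbrev KPlus (Y : Type v) (H : Type u) [NormedAddCommGroup Y] [InnerProductSpace ℂ Y]
    [NormedAddCommGroup H] [InnerProductSpace ℂ H] : Type (max u v) :=
  WithLp 2 (SeqSum Y × H)

/-- The projection of `K₊` onto the copy of `Y` at position `-1`. -/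
def projY (Y : Type v) (H : Type u) [NormedAddCommGroup Y] [InnerProductSpace ℂ Y]
    [NormedAddCommGroup H] [InnerProductSpace ℂ H] : KPlus Y H →L[ℂ] Y :=
  projZero Y ∘L WithLp.fstL 2 ℂ (SeqSum Y) H

/-- The projection of `K₊` onto `H`. -/
def projH (Y : Type v) (H : Type u) [NormedAddCommGroup Y] [InnerProductSpace ℂ Y]
    [NormedAddCommGroup H] [InnerProductSpace ℂ H] : KPlus Y H →L[ℂ] H :=
  WithLp.sndL 2 ℂ (SeqSum Y) H

/-- An operator into an orthogonal sum, from its two components. -/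
def intoSum {E A B : Type*} [NormedAddCommGroup E] [InnerProductSpace ℂ E]
    [NormedAddCommGroup A] [InnerProductSpace ℂ A] [NormedAddCommGroup B] [InnerProductSpace ℂ B]
    (f : E →L[ℂ] A) (g : E →L[ℂ] B) : E →L[ℂ] WithLp 2 (A × B) :=
  (WithLp.prodContinuousLinearEquiv 2 ℂ A B).symm.toContinuousLinearMap ∘L f.prod g

/-- The pencil `V(z)` on `K₊`: the entry at position `-n` moves to position `-(n+1)`,
and `h ∈ H` contributes `F(z) h` at position `-1` and `T(z) h` in `H`. -/
def isomDilation (T : LinearPencil H H) (F : LinearPencil H Y) :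
    LinearPencil (KPlus Y H) (KPlus Y H) where
  coeff := ![
    intoSum
      (shiftForward Y ∘L WithLp.fstL 2 ℂ (SeqSum Y) H + inclZero Y ∘L F.coeff 0 ∘L projH Y H)
      (T.coeff 0 ∘L projH Y H),
    intoSum
      (inclZero Y ∘L F.coeff 1 ∘L projH Y H)
      (T.coeff 1 ∘L projH Y H)]

end IsometricDilation

/-! ## The defect pencil of an isometric pencil -/

section Defect

variable {E : Type u} [NormedAddCommGroup E] [InnerProductSpace ℂ E] [CompleteSpace E]

/-- `𝒱 = ⋁_{|ζ| = 1} V(ζ) E`. -/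
def rangeSpan (V : LinearPencil E E) : Submodule ℂ E :=
  (⨆ ζ : Circle, (V.eval ζ).range).topologicalClosure

/-- `𝓛 = E ⊖ 𝒱`. -/
def spaceL (V : LinearPencil E E) : Submodule ℂ E := (rangeSpan V)ᗮ

/-- `𝒦_ζ = 𝒱 ⊖ V(ζ) E`. -/
def spaceK (V : LinearPencil E E) (ζ : Circle) : Submodule ℂ E :=
  rangeSpan V ⊓ ((V.eval ζ).range)ᗮ

instance instCompleteSpaceL (V : LinearPencil E E) : CompleteSpace (spaceL V) :=
  (Submodule.isClosed_orthogonal _).completeSpace_coe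

instance instCompleteSpaceK (V : LinearPencil E E) (ζ : Circle) : CompleteSpace (spaceK V ζ) :=
  ((Submodule.isClosed_topologicalClosure _).inter
    (Submodule.isClosed_orthogonal _)).completeSpace_coe

/-- `P(z) = P_{closure(V₀ E)} + z P_{closure(V₁ E)}`, as operators on `E`. -/
def diagPencil (V : LinearPencil E E) : LinearPencil E E where
  coeff i := ((V.coeff i).range.topologicalClosure).starProjection

/-- `𝒰 = 𝒦₁ ⊕ 𝓛`. -/
abbrev DefectSpace (V : LinearPencil E E) : Type u := WithLp 2 (spaceK V 1 × spaceL V)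

/-- `Q(z) = [P(z)|𝒦₁  0; 0  I_𝓛] : 𝒰 = 𝒦₁ ⊕ 𝓛 → E`, that is, `Q(z)(k, l) = P(z) k + l`. -/
def defectPencil (V : LinearPencil E E) : LinearPencil (DefectSpace V) E where
  coeff := ![
    (diagPencil V).coeff 0 ∘L (spaceK V 1).subtypeL ∘L WithLp.fstL 2 ℂ (spaceK V 1) (spaceL V)
      + (spaceL V).subtypeL ∘L WithLp.sndL 2 ℂ (spaceK V 1) (spaceL V),
    (diagPencil V).coeff 1 ∘L (spaceK V 1).subtypeL ∘L WithLp.fstL 2 ℂ (spaceK V 1) (spaceL V)]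

theorem defectPencil_eval (V : LinearPencil E E) (z : ℂ) (x : DefectSpace V) :
    (defectPencil V).eval z x = (diagPencil V).eval z x.fst + x.snd := by
  simp [defectPencil, LinearPencil.eval]
  abel

end Defect

/-! ## The unitary dilation -/

section UnitaryDilation

variable {H : Type u} {Y : Type v} {U : Type w}
  [NormedAddCommGroup H] [InnerProductSpace ℂ H]
  [NormedAddCommGroup Y] [InnerProductSpace ℂ Y]
  [NormedAddCommGroup U] [InnerProductSpace ℂ U]

/-- `K = (⨁_{-∞}^{-1} Y) ⊕ H ⊕ (⨁_1^∞ U)`. The entry of index `n : ℕ` of the last component is the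
one at position `n+1`. -/
abbrev KFull (Y : Type v) (H : Type u) (U : Type w)
    [NormedAddCommGroup Y] [InnerProductSpace ℂ Y] [NormedAddCommGroup H] [InnerProductSpace ℂ H]
    [NormedAddCommGroup U] [InnerProductSpace ℂ U] : Type (max u v w) :=
  WithLp 2 (KPlus Y H × SeqSum U)

/-- The component `⨁ Y` of `K`. -/
def compY (Y : Type v) (H : Type u) (U : Type w)
    [NormedAddCommGroup Y] [InnerProductSpace ℂ Y] [NormedAddCommGroup H] [InnerProductSpace ℂ H]
    [NormedAddCommGroup U] [InnerProductSpace ℂ U] : KFull Y H U →L[ℂ] SeqSum Y :=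
  WithLp.fstL 2 ℂ (SeqSum Y) H ∘L WithLp.fstL 2 ℂ (KPlus Y H) (SeqSum U)

/-- The component `H` of `K`. -/
def compH (Y : Type v) (H : Type u) (U : Type w)
    [NormedAddCommGroup Y] [InnerProductSpace ℂ Y] [NormedAddCommGroup H] [InnerProductSpace ℂ H]
    [NormedAddCommGroup U] [InnerProductSpace ℂ U] : KFull Y H U →L[ℂ] H :=
  WithLp.sndL 2 ℂ (SeqSum Y) H ∘L WithLp.fstL 2 ℂ (KPlus Y H) (SeqSum U)

/-- The component `⨁ U` of `K`. -/
def compU (Y : Type v) (H : Type u) (U : Type w)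
    [NormedAddCommGroup Y] [InnerProductSpace ℂ Y] [NormedAddCommGroup H] [InnerProductSpace ℂ H]
    [NormedAddCommGroup U] [InnerProductSpace ℂ U] : KFull Y H U →L[ℂ] SeqSum U :=
  WithLp.sndL 2 ℂ (KPlus Y H) (SeqSum U)

/-- The pencil of block matrices on `K` whose only entries are `F(z) : H → Y₋₁`, `T(z) : H → H`,
`A(z) : U₁ → Y₋₁`, `B(z) : U₁ → H` and the identities `Y₋ₙ → Y₋₍ₙ₊₁₎`, `Uₙ₊₁ → Uₙ` (`n ≥ 1`). -/
def blockPencil (T : LinearPencil H H) (F : LinearPencil H Y)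
    (A : LinearPencil U Y) (B : LinearPencil U H) :
    LinearPencil (KFull Y H U) (KFull Y H U) where
  coeff := ![
    intoSum
      (intoSum
        (shiftForward Y ∘L compY Y H U +
          inclZero Y ∘L (F.coeff 0 ∘L compH Y H U + A.coeff 0 ∘L projZero U ∘L compU Y H U))
        (T.coeff 0 ∘L compH Y H U + B.coeff 0 ∘L projZero U ∘L compU Y H U))
      (shiftBackward U ∘L compU Y H U),
    intoSum
      (intoSum
        (inclZero Y ∘L (F.coeff 1 ∘L compH Y H U + A.coeff 1 ∘L projZero U ∘L compU Y H U))
        (T.coeff 1 ∘L compH Y H U + B.coeff 1 ∘L projZero U ∘L compU Y H U))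
      0]

section Entries

variable (T : LinearPencil H H) (F : LinearPencil H Y) (A : LinearPencil U Y)
  (B : LinearPencil U H) (z : ℂ) (k : KFull Y H U)

/-- Row `-1`. -/
theorem blockPencil_row_Y_zero :
    ((blockPencil T F A B).eval z k).fst.fst 0 =
      F.eval z k.fst.snd + A.eval z (k.snd 0) := by
  change (projZero Y ∘L compY Y H U) ((blockPencil T F A B).eval z k) = _
  simp only [LinearPencil.eval, add_apply, smul_apply, map_add, map_smul]
  simp [blockPencil, intoSum, compY, compH, compU]
  abel

/-- Row `-(n+2)`. -/
theorem blockPencil_row_Y_succ (n : ℕ) :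
    ((blockPencil T F A B).eval z k).fst.fst (n + 1) = k.fst.fst n := by
  change (lp.evalCLM ℂ (fun _ : ℕ => Y) 2 (n + 1) ∘L compY Y H U)
    ((blockPencil T F A B).eval z k) = _
  have e : ∀ x, lp.evalCLM ℂ (fun _ : ℕ => Y) 2 (n + 1) x = x (n + 1) := fun _ => rfl
  simp only [LinearPencil.eval, add_apply, smul_apply, map_add, map_smul]
  simp [e, blockPencil, intoSum, compY, compH, compU]

/-- Row `0`. -/
theorem blockPencil_row_H :
    ((blockPencil T F A B).eval z k).fst.snd =
      T.eval z k.fst.snd + B.eval z (k.snd 0) := by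
  simp [blockPencil, LinearPencil.eval, intoSum, compH, compU]
  abel

/-- Row `n+1`. -/
theorem blockPencil_row_U (n : ℕ) :
    ((blockPencil T F A B).eval z k).snd n = k.snd (n + 1) := by
  simp [blockPencil, LinearPencil.eval, intoSum, compU]

end Entries

/-- The embedding of `H` into `K` at position `0`. -/
def embH (Y : Type v) (H : Type u) (U : Type w)
    [NormedAddCommGroup Y] [InnerProductSpace ℂ Y] [NormedAddCommGroup H] [InnerProductSpace ℂ H]
    [NormedAddCommGroup U] [InnerProductSpace ℂ U] : H →ₗᵢ[ℂ] KFull Y H U where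
  toLinearMap := (intoSum (intoSum 0 (ContinuousLinearMap.id ℂ H)) 0 : H →L[ℂ] KFull Y H U)
  norm_map' h := by
    change ‖WithLp.toLp 2 (WithLp.toLp 2 ((0 : SeqSum Y), h), (0 : SeqSum U))‖ = ‖h‖
    rw [WithLp.norm_toLp_fst, WithLp.norm_toLp_snd]

end UnitaryDilation

section Construction

variable {H : Type u} {Y : Type v}
  [NormedAddCommGroup H] [InnerProductSpace ℂ H] [CompleteSpace H]
  [NormedAddCommGroup Y] [InnerProductSpace ℂ Y] [CompleteSpace Y]

/-- The pencil `Q(z) : 𝒰 → K₊` of the isometric pencil `V(z)` built from `T` and `F`. -/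
def pencilQ (T : LinearPencil H H) (F : LinearPencil H Y) :
    LinearPencil (DefectSpace (isomDilation T F)) (KPlus Y H) :=
  defectPencil (isomDilation T F)

/-- The space `K = (⨁_{-∞}^{-1} Y) ⊕ H ⊕ (⨁_1^∞ 𝒰)`. -/
abbrev DilationSpace (T : LinearPencil H H) (F : LinearPencil H Y) : Type (max u v) :=
  KFull Y H (DefectSpace (isomDilation T F))

/-- The pencil `U(z)` of block operators on `K`, with blocks `F(z)`, `P_Y Q(z)`, `T(z)`,
`P_H Q(z)` and identities. -/
def unitaryDilation (T : LinearPencil H H) (F : LinearPencil H Y) :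
    LinearPencil (DilationSpace T F) (DilationSpace T F) :=
  blockPencil T F
    ⟨fun i => projY Y H ∘L (pencilQ T F).coeff i⟩
    ⟨fun i => projH Y H ∘L (pencilQ T F).coeff i⟩

end Construction

end PencilDilation

end

/-!
The Taylor coefficients identify `H²_X(𝔻)` with `ℓ²(X)`, and `z ↦ F₀ + z F₁` acts there as the
operator `M_F = F₀ ⊕ F₁ S`, where `S` is the shift. Since `M_T` is a contraction, `1 - M_T* M_T` has
the form `D* D` with `D` of dense range. As `M_T` commutes with `S`, there is an isometry `W` with
`W D = D S`, and `D` sends the constants into the orthogonal complement of the range of `W²`. This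
complement is `L ⊕ W L`, where `L` is the wandering space of `W`, so the components of `D` on
constants are the coefficients of a linear pencil `F`. The isometry `Φ : ℓ²(L) → ⨁ Wⁿ L` satisfies
`Φ M_F = D`, which makes `F` outer and a factor of `1 - T* T`.

Given such an `F`, the column `(F(ζ), T(ζ))` is isometric, hence so is `V(ζ)`. Comparing Fourier
coefficients in `V(ζ)* V(ζ) = 1` shows that `V₀` and `V₁` have orthogonal ranges, so that
`P(ζ) V(1) = V(ζ)` and `Q(ζ)` is an isometry onto the orthogonal complement of the range of `V(ζ)`.
Thus the block matrix `U(ζ)` is unitary, and by triangularity it is a uniform dilation.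

If a unitary pencil on a closed subspace `M ⊇ H` is dilated by `U`, then `U` maps `M` onto itself,
for a compression of a unitary operator that is itself unitary is a restriction. Then `M` contains
`F(ζ) H` in the last copy of `Y`, hence `F₀ H`, which is dense since `F` is outer. Applying `U` and
its inverse, `M` contains all copies of `Y` and all copies of `𝒰`.
-/

noncomputable section

namespace PencilDilation

section HardySpace

theorem hardyNorm_le_hardyNorm {X : Type u} {Y : Type v} [NormedAddCommGroup X]
    [NormedAddCommGroup Y] {x : ℂ → X} {y : ℂ → Y}
    (h : ∀ z ∈ Metric.ball (0 : ℂ) 1, ‖x z‖ ≤ ‖y z‖) : hardyNorm x ≤ hardyNorm y := by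
  unfold hardyNorm
  gcongr with r hr s
  refine enorm_le_iff_norm_le.2 (h _ ?_)
  simpa [Complex.norm_exp_ofReal_mul_I, abs_of_pos hr.1] using hr.2

variable {X : Type u} [NormedAddCommGroup X] [InnerProductSpace ℂ X]

theorem integral_exp_int_mul_I (k : ℤ) :
    ∫ s in (0 : ℝ)..2 * Real.pi, Complex.exp (k * s * Complex.I) =
      if k = 0 then 2 * Real.pi else 0 := by
  split_ifs with h
  · simp [h]
  · have hc : (k * Complex.I : ℂ) ≠ 0 := by simp [h]
    have hperiod : Complex.exp (k * Complex.I * (2 * Real.pi : ℝ)) = 1 :=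
      Complex.exp_eq_one_iff.2 ⟨k, by push_cast; ring⟩
    simp only [mul_right_comm _ _ Complex.I, integral_exp_mul_complex hc, hperiod]
    simp

theorem norm_sq_trigPolynomial (N : ℕ) (b : ℕ → X) (s : ℝ) :
    ((‖∑ n ∈ Finset.range N, Complex.exp (s * Complex.I) ^ n • b n‖ ^ 2 : ℝ) : ℂ) =
      ∑ n ∈ Finset.range N, ∑ m ∈ Finset.range N,
        Complex.exp (((m - n : ℤ) : ℂ) * s * Complex.I) * ⟪b n, b m⟫_ℂ := by
  push_cast
  rw [← Complex.coe_algebraMap, ← inner_self_eq_norm_sq_to_K (𝕜 := ℂ), sum_inner]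
  refine Finset.sum_congr rfl fun n _ => ?_
  rw [inner_sum]
  refine Finset.sum_congr rfl fun m _ => ?_
  rw [inner_smul_left, inner_smul_right, ← mul_assoc, map_pow, ← Complex.exp_conj,
    ← Complex.exp_nat_mul, ← Complex.exp_nat_mul, ← Complex.exp_add]
  congr 2
  simp only [map_mul, Complex.coe_algebraMap, Complex.conj_ofReal, Complex.conj_I]
  ring

theorem integral_norm_sq_trigPolynomial (N : ℕ) (b : ℕ → X) :
    ∫ s in (0 : ℝ)..2 * Real.pi,
        ‖∑ n ∈ Finset.range N, Complex.exp (s * Complex.I) ^ n • b n‖ ^ 2 =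
      2 * Real.pi * ∑ n ∈ Finset.range N, ‖b n‖ ^ 2 := by
  apply Complex.ofReal_injective
  rw [← intervalIntegral.integral_ofReal]
  simp only [norm_sq_trigPolynomial]
  rw [intervalIntegral.integral_finsetSum fun n _ =>
    Continuous.intervalIntegrable (by fun_prop) _ _, Complex.ofReal_mul, Complex.ofReal_sum,
    Finset.mul_sum]
  refine Finset.sum_congr rfl fun n hn => ?_
  rw [intervalIntegral.integral_finsetSum fun m _ =>
    Continuous.intervalIntegrable (by fun_prop) _ _]
  simp only [intervalIntegral.integral_mul_const, integral_exp_int_mul_I, sub_eq_zero,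
    Nat.cast_inj]
  rw [Finset.sum_eq_single_of_mem n hn fun m _ hm => by rw [if_neg hm]; simp, if_pos rfl,
    inner_self_eq_norm_sq_to_K, Complex.ofReal_pow]
  rfl

theorem enorm_sq_eq_ofReal {E : Type*} [SeminormedAddCommGroup E] (x : E) :
    ‖x‖ₑ ^ 2 = ENNReal.ofReal (‖x‖ ^ 2) := by
  rw [ENNReal.ofReal_pow (norm_nonneg _), ofReal_norm]

theorem lintegral_enorm_sq_trigPolynomial (N : ℕ) (b : ℕ → X) :
    ∫⁻ s in Set.Icc (0 : ℝ) (2 * Real.pi),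
        ‖∑ n ∈ Finset.range N, Complex.exp (s * Complex.I) ^ n • b n‖ₑ ^ 2 =
      ENNReal.ofReal (2 * Real.pi) * ∑ n ∈ Finset.range N, ‖b n‖ₑ ^ 2 := by
  have hc : Continuous fun s : ℝ =>
      ‖∑ n ∈ Finset.range N, Complex.exp (s * Complex.I) ^ n • b n‖ ^ 2 := by fun_prop
  simp only [enorm_sq_eq_ofReal]
  rw [← ENNReal.ofReal_sum_of_nonneg fun _ _ => by positivity,
    ← ENNReal.ofReal_mul (by positivity), ← integral_norm_sq_trigPolynomial,
    intervalIntegral.integral_of_le (by positivity),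
    ← MeasureTheory.integral_Icc_eq_integral_Ioc,
    MeasureTheory.ofReal_integral_eq_lintegral_ofReal
      (hc.continuousOn.integrableOn_compact isCompact_Icc)
      (Filter.Eventually.of_forall fun _ => by positivity)]

/-- `a` is the sequence of Taylor coefficients at `0` of `x`, whose Taylor series converges to `x`
on the open unit disk. -/
def HasTaylorCoeffs (x : ℂ → X) (a : ℕ → X) : Prop :=
  ∀ z ∈ Metric.ball (0 : ℂ) 1, HasSum (fun n => z ^ n • a n) (x z)

theorem exists_hasTaylorCoeffs [CompleteSpace X] {x : ℂ → X}
    (hx : DifferentiableOn ℂ x (Metric.ball 0 1)) : ∃ a, HasTaylorCoeffs x a := by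
  refine ⟨fun n => ((n.factorial : ℂ)⁻¹) • iteratedDeriv n x 0, fun z hz => ?_⟩
  simpa [smul_smul, mul_comm] using Complex.hasSum_taylorSeries_on_ball hx hz

namespace HasTaylorCoeffs

variable {x y : ℂ → X} {a b : ℕ → X}

theorem sub (hx : HasTaylorCoeffs x a) (hy : HasTaylorCoeffs y b) :
    HasTaylorCoeffs (fun z => x z - y z) (a - b) := fun z hz => by
  simpa only [Pi.sub_apply, smul_sub] using (hx z hz).sub (hy z hz)

theorem summable_pow_mul_norm (h : HasTaylorCoeffs x a) {r : ℝ} (hr₀ : 0 ≤ r) (hr₁ : r < 1) :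
    Summable fun n => r ^ n * ‖a n‖ := by
  obtain ⟨q, hrq, hq₁⟩ := exists_between hr₁
  have hq₀ : 0 < q := hr₀.trans_lt hrq
  obtain ⟨C, hC⟩ := (h q (by simpa [abs_of_pos hq₀] using hq₁)).summable.tendsto_atTop_zero.norm
    |>.bddAbove_range
  have hqC : ∀ n, q ^ n * ‖a n‖ ≤ C := fun n => by
    simpa [norm_smul, abs_of_pos hq₀] using hC ⟨n, rfl⟩
  have hgeom : Summable fun n => C * (r / q) ^ n :=
    (summable_geometric_of_lt_one (by positivity) ((div_lt_one hq₀).2 hrq)).mul_left C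
  refine hgeom.of_nonneg_of_le (fun n => by positivity) fun n => ?_
  calc r ^ n * ‖a n‖ = (q ^ n * ‖a n‖) * (r / q) ^ n := by
        rw [div_pow]; field_simp
    _ ≤ C * (r / q) ^ n := by
        gcongr
        exact hqC n

theorem differentiableOn [CompleteSpace X] (h : HasTaylorCoeffs x a) :
    DifferentiableOn ℂ x (Metric.ball 0 1) := by
  intro z hz
  obtain ⟨r, hzr, hr₁⟩ := exists_between (mem_ball_zero_iff.1 hz)
  have hsub : Metric.ball (0 : ℂ) r ⊆ Metric.ball 0 1 := Metric.ball_subset_ball hr₁.le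
  have hd : DifferentiableOn ℂ (fun w : ℂ => ∑' n, w ^ n • a n) (Metric.ball 0 r) :=
    Complex.differentiableOn_tsum_of_summable_norm (F := fun n w => w ^ n • a n)
      (h.summable_pow_mul_norm ((norm_nonneg z).trans hzr.le) hr₁)
      (fun n => by fun_prop) Metric.isOpen_ball fun n w hw => by
        rw [norm_smul, norm_pow]
        gcongr
        exact (mem_ball_zero_iff.1 hw).le
  exact ((hd.congr fun w hw => (h w (hsub hw)).tsum_eq.symm).differentiableAt
    (Metric.isOpen_ball.mem_nhds (mem_ball_zero_iff.2 hzr))).differentiableWithinAt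

theorem lintegral_circle (h : HasTaylorCoeffs x a) {r : ℝ} (hr₀ : 0 < r) (hr₁ : r < 1) :
    ∫⁻ s in Set.Icc (0 : ℝ) (2 * Real.pi), ‖x (r * Complex.exp (s * Complex.I))‖ₑ ^ 2 =
      ENNReal.ofReal (2 * Real.pi) * ∑' n, ‖((r : ℂ) ^ n) • a n‖ₑ ^ 2 := by
  have hs := h.summable_pow_mul_norm hr₀.le hr₁
  have hpartial : Filter.Tendsto (fun N => ∫⁻ s in Set.Icc (0 : ℝ) (2 * Real.pi),
      ‖∑ n ∈ Finset.range N, Complex.exp (s * Complex.I) ^ n • ((r : ℂ) ^ n) • a n‖ₑ ^ 2)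
      Filter.atTop (nhds (∫⁻ s in Set.Icc (0 : ℝ) (2 * Real.pi),
        ‖x (r * Complex.exp (s * Complex.I))‖ₑ ^ 2)) := by
    refine MeasureTheory.tendsto_lintegral_of_dominated_convergence
      (fun _ => ENNReal.ofReal (∑' n, r ^ n * ‖a n‖) ^ 2)
      (fun N => Continuous.measurable (by fun_prop))
      (fun N => Filter.Eventually.of_forall fun s => ?_) (by simp [ENNReal.mul_ne_top])
      (Filter.Eventually.of_forall fun s => ?_)
    · beta_reduce
      rw [← ofReal_norm]
      gcongr
      refine (norm_sum_le _ _).trans ?_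
      simp only [norm_smul, norm_pow, Complex.norm_exp_ofReal_mul_I, one_pow, one_mul,
        Complex.norm_real, Real.norm_of_nonneg hr₀.le]
      exact hs.sum_le_tsum _ fun n _ => by positivity
    · have hz : (r : ℂ) * Complex.exp (s * Complex.I) ∈ Metric.ball (0 : ℂ) 1 := by
        simpa [Complex.norm_exp_ofReal_mul_I, abs_of_pos hr₀] using hr₁
      have hsum := (h _ hz).tendsto_sum_nat
      simp only [mul_pow, mul_comm ((r : ℂ) ^ _), mul_smul] at hsum
      exact (ENNReal.continuous_pow 2).continuousAt.tendsto.comp hsum.enorm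
  simp only [lintegral_enorm_sq_trigPolynomial] at hpartial
  exact tendsto_nhds_unique hpartial (ENNReal.Tendsto.const_mul
    (ENNReal.tendsto_nat_tsum _) (.inr ENNReal.ofReal_ne_top))

end HasTaylorCoeffs

theorem iSup_tsum_enorm_pow_smul_sq (a : ℕ → X) :
    ⨆ r ∈ Set.Ioo (0 : ℝ) 1, ∑' n, ‖((r : ℂ) ^ n) • a n‖ₑ ^ 2 = ∑' n, ‖a n‖ₑ ^ 2 := by
  refine le_antisymm (iSup₂_le fun r hr => ENNReal.tsum_le_tsum fun n => ?_) ?_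
  · simp only [enorm_sq_eq_ofReal]
    gcongr
    simpa [norm_smul, abs_of_pos hr.1] using
      mul_le_of_le_one_left (norm_nonneg _) (pow_le_one₀ hr.1.le hr.2.le)
  · rw [ENNReal.tsum_eq_iSup_sum]
    refine iSup_le fun s => ?_
    have hc : Continuous fun r : ℝ => ∑ n ∈ s, ‖((r : ℂ) ^ n) • a n‖ₑ ^ 2 :=
      continuous_finsetSum _ fun n _ => (ENNReal.continuous_pow 2).comp (by fun_prop)
    have ht : Filter.Tendsto (fun r : ℝ => ∑ n ∈ s, ‖((r : ℂ) ^ n) • a n‖ₑ ^ 2)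
        (nhdsWithin 1 (Set.Iio 1)) (nhds (∑ n ∈ s, ‖a n‖ₑ ^ 2)) := by
      simpa using (hc.tendsto 1).mono_left (nhdsWithin_le_nhds (s := Set.Iio 1))
    refine le_of_tendsto ht ?_
    filter_upwards [Ioo_mem_nhdsLT (zero_lt_one' ℝ)] with r hr
    exact (ENNReal.sum_le_tsum s).trans
      (le_iSup₂ (f := fun (r : ℝ) (_ : r ∈ Set.Ioo (0 : ℝ) 1) =>
        ∑' n, ‖((r : ℂ) ^ n) • a n‖ₑ ^ 2) r hr)

theorem HasTaylorCoeffs.hardyNorm_sq {x : ℂ → X} {a : ℕ → X} (h : HasTaylorCoeffs x a) :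
    hardyNorm x ^ 2 = ∑' n, ‖a n‖ₑ ^ 2 := by
  have hpi : ENNReal.ofReal (2 * Real.pi) ≠ 0 := by simp [Real.pi_pos]
  have hsup : ⨆ r ∈ Set.Ioo (0 : ℝ) 1, ∫⁻ s in Set.Icc (0 : ℝ) (2 * Real.pi),
      ‖x (r * Complex.exp (s * Complex.I))‖ₑ ^ 2 =
      ENNReal.ofReal (2 * Real.pi) * ∑' n, ‖a n‖ₑ ^ 2 := by
    rw [← iSup_tsum_enorm_pow_smul_sq]
    simp only [ENNReal.mul_iSup]
    exact iSup_congr fun r => iSup_congr fun hr => h.lintegral_circle hr.1 hr.2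
  rw [hardyNorm, hsup, ← mul_assoc, ENNReal.inv_mul_cancel hpi ENNReal.ofReal_ne_top, one_mul,
    ← ENNReal.rpow_natCast, ← ENNReal.rpow_mul]
  norm_num

theorem enorm_sq_eq_tsum (a : SeqSum X) : ‖a‖ₑ ^ 2 = ∑' n, ‖a n‖ₑ ^ 2 := by
  simp only [enorm_sq_eq_ofReal, norm_sq_tsum]
  exact ENNReal.ofReal_tsum_of_nonneg (fun _ => by positivity) (summable_sq a)

theorem HasTaylorCoeffs.hardyNorm_eq_enorm {x : ℂ → X} {a : SeqSum X} (h : HasTaylorCoeffs x a) :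
    hardyNorm x = ‖a‖ₑ := by
  refine (ENNReal.pow_right_strictMono two_ne_zero).injective ?_
  rw [h.hardyNorm_sq, enorm_sq_eq_tsum]

variable [CompleteSpace X]

theorem exists_hasTaylorCoeffs_of_seqSum (a : SeqSum X) : ∃ x, HasTaylorCoeffs x a := by
  refine ⟨fun z => ∑' n, z ^ n • a n, fun z hz => Summable.hasSum ?_⟩
  have hgeom : Summable fun n => ‖z‖ ^ n * ‖a‖ :=
    (summable_geometric_of_lt_one (norm_nonneg z) (mem_ball_zero_iff.1 hz)).mul_right _
  refine hgeom.of_norm_bounded fun n => ?_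
  rw [norm_smul, norm_pow]
  gcongr
  exact lp.norm_apply_le_norm two_ne_zero a n

theorem memHardy_iff {x : ℂ → X} : MemHardy x ↔ ∃ a : SeqSum X, HasTaylorCoeffs x a := by
  refine ⟨fun ⟨hd, hlt⟩ => ?_, fun ⟨a, ha⟩ => ⟨ha.differentiableOn, ?_⟩⟩
  · obtain ⟨a, ha⟩ := exists_hasTaylorCoeffs hd
    have hsum : ∑' n, ‖a n‖ₑ ^ 2 ≠ ∞ := ha.hardyNorm_sq ▸ ENNReal.pow_ne_top hlt.ne
    refine ⟨⟨a, memlp_of_summable_sq ?_⟩, ha⟩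
    simpa using ENNReal.summable_toReal hsum
  · rw [ha.hardyNorm_eq_enorm]
    exact enorm_lt_top

end HardySpace

section Pencil

variable {E : Type u} {F : Type v} [NormedAddCommGroup E] [InnerProductSpace ℂ E]
  [NormedAddCommGroup F] [InnerProductSpace ℂ F]

theorem coe_circle_mul_conj (ζ : Circle) : (ζ : ℂ) * starRingEnd ℂ ζ = 1 := by
  simp [Complex.mul_conj]

namespace LinearPencil

theorem eval_apply (A : LinearPencil E F) (z : ℂ) (x : E) :
    A.eval z x = A.coeff 0 x + z • A.coeff 1 x := by
  simp [eval]

theorem differentiable_eval (A : LinearPencil E F) : Differentiable ℂ A.eval := by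
  unfold eval
  fun_prop

theorem coeff_mem_of_forall_eval_mem (A : LinearPencil E F) (M : Submodule ℂ F) {x : E}
    (h : ∀ ζ : Circle, A.eval ζ x ∈ M) (i : Fin 2) : A.coeff i x ∈ M := by
  have hpos : A.coeff 0 x + A.coeff 1 x ∈ M := by simpa [eval_apply] using h 1
  have hneg : A.coeff 0 x - A.coeff 1 x ∈ M := by simpa [eval_apply, sub_eq_add_neg] using h (-1)
  fin_cases i
  · convert M.smul_mem (1 / 2 : ℂ) (M.add_mem hpos hneg) using 1
    simp only [Fin.zero_eta]
    module
  · convert M.smul_mem (1 / 2 : ℂ) (M.sub_mem hpos hneg) using 1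
    simp only [Fin.mk_one]
    module

-- `z` lies on the segment between `ζ = z / ‖z‖` and `-ζ`, and `A` is affine.
theorem norm_eval_le_one {A : LinearPencil E F} (hA : ∀ ζ : Circle, ‖A.eval ζ‖ ≤ 1) {z : ℂ}
    (hz : ‖z‖ ≤ 1) : ‖A.eval z‖ ≤ 1 := by
  have hconvex : A.eval z = ((1 + ‖z‖) / 2 : ℝ) • A.eval (Circle.exp z.arg) +
      ((1 - ‖z‖) / 2 : ℝ) • A.eval (-Circle.exp z.arg : Circle) := by
    ext x
    have hpolar : z = ‖z‖ * (Circle.exp z.arg : ℂ) := by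
      rw [Circle.coe_exp, Complex.norm_mul_exp_arg_mul_I]
    simp only [add_apply, smul_apply, eval_apply]
    rw [Circle.coe_neg]
    conv_lhs => rw [hpolar]
    simp only [← Complex.coe_smul]
    push_cast
    module
  rw [hconvex]
  refine (norm_add_le _ _).trans ?_
  rw [norm_smul, norm_smul, Real.norm_of_nonneg (by positivity),
    Real.norm_of_nonneg (by linarith)]
  nlinarith [norm_nonneg z, hA (Circle.exp z.arg), hA (-Circle.exp z.arg)]

end LinearPencil

end Pencil

section MulOperator

variable {X : Type u} {Y : Type v} [NormedAddCommGroup X] [InnerProductSpace ℂ X]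
  [NormedAddCommGroup Y] [InnerProductSpace ℂ Y]

/-- The operator `(x₀, x₁, …) ↦ (A x₀, A x₁, …)` between sums of countably many copies. -/
def mapSeq (A : X →L[ℂ] Y) : SeqSum X →L[ℂ] SeqSum Y :=
  have hsq (x : SeqSum X) (n : ℕ) : ‖A (x n)‖ ^ 2 ≤ ‖A‖ ^ 2 * ‖x n‖ ^ 2 := by
    rw [← mul_pow]
    gcongr
    exact A.le_opNorm _
  have hsum (x : SeqSum X) : Summable fun n => ‖A (x n)‖ ^ 2 :=
    ((summable_sq x).mul_left _).of_nonneg_of_le (fun _ => by positivity) (hsq x)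
  LinearMap.mkContinuous
    { toFun := fun x => ⟨fun n => A (x n), memlp_of_summable_sq (hsum x)⟩
      map_add' := fun x y => by ext n; exact map_add A (x n) (y n)
      map_smul' := fun c x => by ext n; exact map_smul A c (x n) } ‖A‖ fun x => by
    refine le_of_sq_le_sq ?_ (by positivity)
    rw [mul_pow, norm_sq_tsum, norm_sq_tsum, ← tsum_mul_left]
    exact (hsum x).tsum_le_tsum (hsq x) ((summable_sq x).mul_left _)

@[simp] theorem mapSeq_apply (A : X →L[ℂ] Y) (x : SeqSum X) (n : ℕ) : mapSeq A x n = A (x n) := rfl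

/-- Multiplication by the function `F(z) = F₀ + z F₁` in terms of Taylor coefficients:
`(x₀, x₁, …) ↦ (F₀ x₀, F₀ x₁ + F₁ x₀, F₀ x₂ + F₁ x₁, …)`. -/
def LinearPencil.mulOperator (F : LinearPencil X Y) : SeqSum X →L[ℂ] SeqSum Y :=
  mapSeq (F.coeff 0) + shiftForward Y ∘L mapSeq (F.coeff 1)

namespace LinearPencil

variable (F : LinearPencil X Y)

theorem mulOperator_apply_zero (x : SeqSum X) : F.mulOperator x 0 = F.coeff 0 (x 0) := by
  simp [mulOperator]

theorem mulOperator_apply_succ (x : SeqSum X) (n : ℕ) :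
    F.mulOperator x (n + 1) = F.coeff 0 (x (n + 1)) + F.coeff 1 (x n) := by
  simp [mulOperator]

theorem mulOperator_apply_one (x : SeqSum X) :
    F.mulOperator x 1 = F.coeff 0 (x 1) + F.coeff 1 (x 0) :=
  F.mulOperator_apply_succ x 0

theorem mulOperator_shiftForward (x : SeqSum X) :
    F.mulOperator (shiftForward X x) = shiftForward Y (F.mulOperator x) := by
  ext (_ | _ | n) <;> simp [mulOperator]

theorem mulOperator_inclZero (x : X) :
    F.mulOperator (inclZero X x) =
      inclZero Y (F.coeff 0 x) + shiftForward Y (inclZero Y (F.coeff 1 x)) := by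
  ext (_ | _ | n) <;> simp [mulOperator]

end LinearPencil

theorem HasTaylorCoeffs.mulOperator (F : LinearPencil X Y) {x : ℂ → X} {a : SeqSum X}
    (h : HasTaylorCoeffs x a) :
    HasTaylorCoeffs (fun z => F.eval z (x z)) (F.mulOperator a) := by
  intro z hz
  have hcoeff₀ : HasSum (fun n => z ^ n • F.coeff 0 (a n)) (F.coeff 0 (x z)) := by
    simpa using (h z hz).mapL (F.coeff 0)
  have hcoeff₁ : HasSum (fun n => z ^ (n + 1) • F.coeff 1 (a n)) (z • F.coeff 1 (x z)) := by
    simpa [pow_succ', mul_smul] using ((h z hz).mapL (F.coeff 1)).const_smul z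
  rw [← hasSum_nat_add_iff' 1] at hcoeff₀ ⊢
  convert hcoeff₀.add hcoeff₁ using 1
  · ext n
    rw [F.mulOperator_apply_succ, smul_add]
  · simp only [Finset.range_one, Finset.sum_singleton, pow_zero, one_smul,
      F.mulOperator_apply_zero, F.eval_apply]
    abel

theorem norm_mulOperator_apply_le [CompleteSpace X] {F : LinearPencil X Y}
    (hF : ∀ z ∈ Metric.ball (0 : ℂ) 1, ‖F.eval z‖ ≤ 1) (a : SeqSum X) :
    ‖F.mulOperator a‖ ≤ ‖a‖ := by
  obtain ⟨x, hx⟩ := exists_hasTaylorCoeffs_of_seqSum a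
  rw [← enorm_le_iff_norm_le, ← hx.hardyNorm_eq_enorm, ← (hx.mulOperator F).hardyNorm_eq_enorm]
  refine hardyNorm_le_hardyNorm fun z hz => ?_
  simpa using (F.eval z).le_of_opNorm_le (hF z hz) (x z)

theorem isOuter_eval_iff [CompleteSpace X] [CompleteSpace Y] (F : LinearPencil X Y) :
    IsOuter F.eval ↔
      (∀ z ∈ Metric.ball (0 : ℂ) 1, ‖F.eval z‖ ≤ 1) ∧ DenseRange F.mulOperator := by
  have hardyNorm_sub {y : ℂ → Y} {x : ℂ → X} {a : SeqSum X} {b : SeqSum Y}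
      (hy : HasTaylorCoeffs y b) (hx : HasTaylorCoeffs x a) :
      hardyNorm (fun z => y z - F.eval z (x z)) = edist b (F.mulOperator a) := by
    rw [edist_eq_enorm_sub]
    exact HasTaylorCoeffs.hardyNorm_eq_enorm (a := b - F.mulOperator a)
      (hy.sub (hx.mulOperator F))
  refine ⟨fun ⟨_, hc, hd⟩ => ⟨hc, fun b => ?_⟩, fun ⟨hc, hd⟩ =>
    ⟨F.differentiable_eval.differentiableOn, hc, fun y hy ε hε => ?_⟩⟩
  · refine EMetric.mem_closure_iff.2 fun ε hε => ?_
    obtain ⟨y, hy⟩ := exists_hasTaylorCoeffs_of_seqSum b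
    obtain ⟨x, hx, hlt⟩ := hd y (memHardy_iff.2 ⟨b, hy⟩) ε hε
    obtain ⟨a, ha⟩ := memHardy_iff.1 hx
    exact ⟨_, ⟨a, rfl⟩, hardyNorm_sub hy ha ▸ hlt⟩
  · obtain ⟨b, hb⟩ := memHardy_iff.1 hy
    obtain ⟨_, ⟨a, rfl⟩, hlt⟩ := EMetric.mem_closure_iff.1 (hd b) ε hε
    obtain ⟨x, hx⟩ := exists_hasTaylorCoeffs_of_seqSum a
    exact ⟨x, memHardy_iff.2 ⟨a, hx⟩, hardyNorm_sub hb hx ▸ hlt⟩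

theorem IsOuter.denseRange_coeff_zero [CompleteSpace X] [CompleteSpace Y] {F : LinearPencil X Y}
    (hF : IsOuter F.eval) : DenseRange (F.coeff 0) := by
  have hproj : DenseRange (projZero Y ∘ F.mulOperator) :=
    (Function.Surjective.denseRange fun y => ⟨inclZero Y y, inclZero_zero y⟩).comp
      ((isOuter_eval_iff F).1 hF).2 (projZero Y).continuous
  refine hproj.mono ?_
  rintro _ ⟨a, rfl⟩
  exact ⟨a 0, (F.mulOperator_apply_zero a).symm⟩

end MulOperator

section Wandering

variable {E : Type u} {R : Type v} [NormedAddCommGroup E] [InnerProductSpace ℂ E]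
  [NormedAddCommGroup R] [InnerProductSpace ℂ R]

theorem shiftForward_single (n : ℕ) (x : E) :
    shiftForward E (lp.single 2 n x) = lp.single 2 (n + 1) x := by
  ext (_ | m)
  · simp
  · simp [Pi.single_apply]

theorem seqSum_ext_of_shiftForward {A B : SeqSum E →L[ℂ] R} {W : R → R}
    (hA : ∀ x, A (shiftForward E x) = W (A x)) (hB : ∀ x, B (shiftForward E x) = W (B x))
    (h : ∀ x, A (inclZero E x) = B (inclZero E x)) : A = B := by
  refine lp.ext_continuousLinearMap (by simp) fun n => ?_
  ext x
  change A (lp.single 2 n x) = B (lp.single 2 n x)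
  induction n with
  | zero => exact h x
  | succ n ih => rw [← shiftForward_single, hA, hB, ih]

/-- The wandering subspace `R ⊖ W R` of an isometry `W`. -/
def wanderingSpace (W : R →ₗᵢ[ℂ] R) : Submodule ℂ R :=
  (LinearMap.range W.toLinearMap)ᗮ

theorem orthogonalFamily_pow_wanderingSpace (W : R →ₗᵢ[ℂ] R) :
    OrthogonalFamily ℂ (fun _ : ℕ => wanderingSpace W)
      fun n => (W ^ n).comp (wanderingSpace W).subtypeₗᵢ := by
  have hlt {m n : ℕ} (hmn : m < n) (x y : wanderingSpace W) :
      ⟪(W ^ m) x, (W ^ n) y⟫_ℂ = 0 := by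
    obtain ⟨k, rfl⟩ := Nat.exists_eq_add_of_lt hmn
    have hpow : (W ^ (m + k + 1)) (y : R) = (W ^ m) (W ((W ^ k) y)) := by
      rw [add_assoc, pow_add, pow_succ']
      rfl
    rw [hpow, LinearIsometry.inner_map_map]
    exact Submodule.inner_left_of_mem_orthogonal (LinearMap.mem_range_self _ _) x.2
  intro m n hmn x y
  rcases hmn.lt_or_gt with h | h
  · exact hlt h x y
  · exact inner_eq_zero_symm.1 (hlt h y x)

variable [CompleteSpace R]

instance (W : R →ₗᵢ[ℂ] R) : CompleteSpace (wanderingSpace W) :=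
  (Submodule.isClosed_orthogonal _).completeSpace_coe

/-- The isometry `(y₀, y₁, …) ↦ ∑ Wⁿ yₙ`, whose range is the shift part of the Wold decomposition
of `W`. -/
def wanderingIsometry (W : R →ₗᵢ[ℂ] R) : SeqSum (wanderingSpace W) →ₗᵢ[ℂ] R :=
  (orthogonalFamily_pow_wanderingSpace W).linearIsometry

theorem wanderingIsometry_single (W : R →ₗᵢ[ℂ] R) (n : ℕ) (y : wanderingSpace W) :
    wanderingIsometry W (lp.single 2 n y) = (W ^ n) y := by
  simp [wanderingIsometry, OrthogonalFamily.linearIsometry_apply_single]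

theorem wanderingIsometry_inclZero (W : R →ₗᵢ[ℂ] R) (y : wanderingSpace W) :
    wanderingIsometry W (inclZero _ y) = y :=
  wanderingIsometry_single W 0 y

theorem wanderingIsometry_shiftForward (W : R →ₗᵢ[ℂ] R) (y : SeqSum (wanderingSpace W)) :
    wanderingIsometry W (shiftForward _ y) = W (wanderingIsometry W y) := by
  suffices h : (wanderingIsometry W).toContinuousLinearMap ∘L shiftForward _ =
      W.toContinuousLinearMap ∘L (wanderingIsometry W).toContinuousLinearMap from
    congr($h y)
  refine lp.ext_continuousLinearMap (by simp) fun n => ?_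
  ext y
  change wanderingIsometry W (shiftForward _ (lp.single 2 n y)) =
    W (wanderingIsometry W (lp.single 2 n y))
  rw [shiftForward_single, wanderingIsometry_single, wanderingIsometry_single, pow_succ']
  rfl

theorem exists_linearPencil_wanderingSpace (W : R →ₗᵢ[ℂ] R) (δ : E →L[ℂ] R)
    (hδ : ∀ x z, ⟪W (W z), δ x⟫_ℂ = 0) :
    ∃ F : LinearPencil E (wanderingSpace W), ∀ x, δ x = F.coeff 0 x + W (F.coeff 1 x) := by
  let A := W.toContinuousLinearMap
  have hadj (z r : R) : ⟪W z, r⟫_ℂ = ⟪z, A.adjoint r⟫_ℂ := (A.adjoint_inner_right z r).symm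
  have hzero (x : E) : δ x - W (A.adjoint (δ x)) ∈ wanderingSpace W := by
    rintro _ ⟨z, rfl⟩
    change ⟪W z, _⟫_ℂ = 0
    rw [inner_sub_right, W.inner_map_map, hadj, sub_self]
  have hone (x : E) : A.adjoint (δ x) ∈ wanderingSpace W := by
    rintro _ ⟨z, rfl⟩
    change ⟪W z, _⟫_ℂ = 0
    rw [← hadj, hδ]
  exact ⟨⟨![(δ - A ∘L A.adjoint ∘L δ).codRestrict _ hzero, (A.adjoint ∘L δ).codRestrict _ hone]⟩,
    fun x => (sub_add_cancel (δ x) (W (A.adjoint (δ x)))).symm⟩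

theorem wanderingIsometry_mulOperator (W : R →ₗᵢ[ℂ] R) {B : SeqSum E →L[ℂ] R}
    (hB : ∀ x, B (shiftForward E x) = W (B x)) {F : LinearPencil E (wanderingSpace W)}
    (hF : ∀ x, B (inclZero E x) = F.coeff 0 x + W (F.coeff 1 x)) (x : SeqSum E) :
    wanderingIsometry W (F.mulOperator x) = B x := by
  suffices h : (wanderingIsometry W).toContinuousLinearMap ∘L F.mulOperator = B from congr($h x)
  refine seqSum_ext_of_shiftForward (fun x => ?_) hB fun x => ?_
  · change wanderingIsometry W (F.mulOperator _) = W (wanderingIsometry W (F.mulOperator _))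
    rw [F.mulOperator_shiftForward, wanderingIsometry_shiftForward]
  · change wanderingIsometry W (F.mulOperator _) = _
    rw [F.mulOperator_inclZero, map_add, wanderingIsometry_shiftForward,
      wanderingIsometry_inclZero, wanderingIsometry_inclZero, hF]

end Wandering

section DefectOperator

variable {E : Type u} [NormedAddCommGroup E] [InnerProductSpace ℂ E]

theorem exists_linearIsometry_of_denseRange {R : Type v} {G : Type w} [NormedAddCommGroup R]
    [InnerProductSpace ℂ R] [NormedAddCommGroup G] [InnerProductSpace ℂ G] [CompleteSpace G]
    {D : E →L[ℂ] R} (hD : DenseRange D) {f : E →L[ℂ] G} (hf : ∀ x, ‖f x‖ = ‖D x‖) :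
    ∃ W : R →ₗᵢ[ℂ] G, ∀ x, W (D x) = f x := by
  let W := f.toLinearMap.extendOfNorm D.toLinearMap
  have hW (x : E) : W (D x) = f x :=
    LinearMap.extendOfNorm_eq hD ⟨1, fun x => by simpa using (hf x).le⟩ x
  have hnorm (r : R) : ‖W r‖ = ‖r‖ :=
    hD.induction_on (p := fun r => ‖W r‖ = ‖r‖) r
      (isClosed_eq W.continuous.norm continuous_norm) fun x => by rw [hW, hf]
  exact ⟨⟨W.toLinearMap, hnorm⟩, hW⟩

theorem exists_defectOperator [CompleteSpace E] {G : Type v} [NormedAddCommGroup G]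
    [InnerProductSpace ℂ G] [CompleteSpace G] {A : E →L[ℂ] G} (hA : ∀ x, ‖A x‖ ≤ ‖x‖) :
    ∃ B : E →L[ℂ] E, ∀ x y, ⟪B x, B y⟫_ℂ = ⟪x, y⟫_ℂ - ⟪A x, A y⟫_ℂ := by
  have hinner (x y : E) : ⟪x, (1 - A.adjoint ∘L A) y⟫_ℂ = ⟪x, y⟫_ℂ - ⟪A x, A y⟫_ℂ := by
    change ⟪x, y - A.adjoint (A y)⟫_ℂ = _
    rw [inner_sub_right, A.adjoint_inner_right]
  have hpos : 0 ≤ 1 - A.adjoint ∘L A := by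
    rw [ContinuousLinearMap.nonneg_iff_isPositive, ContinuousLinearMap.isPositive_iff_complex]
    intro x
    have hreal : ⟪(1 - A.adjoint ∘L A) x, x⟫_ℂ = (‖x‖ ^ 2 - ‖A x‖ ^ 2 : ℝ) := by
      rw [← inner_conj_symm, hinner, inner_self_eq_norm_sq_to_K, inner_self_eq_norm_sq_to_K]
      simp
    rw [hreal]
    simp only [RCLike.re_to_complex, Complex.ofReal_re]
    exact ⟨trivial, sub_nonneg.2 (pow_le_pow_left₀ (norm_nonneg _) (hA x) 2)⟩
  obtain ⟨B, hB⟩ := CStarAlgebra.nonneg_iff_eq_star_mul_self.1 hpos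
  refine ⟨B, fun x y => ?_⟩
  rw [← hinner, hB]
  exact (B.adjoint_inner_right x (B y)).symm

theorem exists_denseRange_defectOperator [CompleteSpace E] {G : Type v} [NormedAddCommGroup G]
    [InnerProductSpace ℂ G] [CompleteSpace G] {A : E →L[ℂ] G} (hA : ∀ x, ‖A x‖ ≤ ‖x‖) :
    ∃ (R : Submodule ℂ E) (_ : CompleteSpace R) (D : E →L[ℂ] R), DenseRange D ∧
      ∀ x y, ⟪D x, D y⟫_ℂ = ⟪x, y⟫_ℂ - ⟪A x, A y⟫_ℂ := by
  obtain ⟨B, hB⟩ := exists_defectOperator hA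
  have hmem (x : E) : B x ∈ B.range.topologicalClosure :=
    Submodule.le_topologicalClosure _ (LinearMap.mem_range_self _ x)
  refine ⟨B.range.topologicalClosure, (Submodule.isClosed_topologicalClosure _).completeSpace_coe,
    B.codRestrict _ hmem, fun r => ?_, hB⟩
  rw [closure_subtype, ← Set.range_comp]
  exact r.2

end DefectOperator

section Factorization

variable {X : Type u} {Y : Type v} [NormedAddCommGroup X] [InnerProductSpace ℂ X]
  [NormedAddCommGroup Y] [InnerProductSpace ℂ Y]

theorem norm_shiftForward (x : SeqSum X) : ‖shiftForward X x‖ = ‖x‖ := by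
  rw [← sq_eq_sq₀ (norm_nonneg _) (norm_nonneg _), norm_sq_tsum, norm_sq_tsum,
    (summable_sq _).tsum_eq_zero_add]
  simp

theorem inner_shiftForward (x y : SeqSum X) :
    ⟪shiftForward X x, shiftForward X y⟫_ℂ = ⟪x, y⟫_ℂ :=
  (LinearMap.norm_map_iff_inner_map_map (shiftForward X)).1 norm_shiftForward x y

theorem inner_inclZero_left (x : X) (y : SeqSum X) : ⟪inclZero X x, y⟫_ℂ = ⟪x, y 0⟫_ℂ :=
  lp.inner_single_left 0 x y

theorem inner_mulOperator_inclZero (F : LinearPencil X Y) (x : X) (y : SeqSum Y) :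
    ⟪F.mulOperator (inclZero X x), y⟫_ℂ = ⟪F.coeff 0 x, y 0⟫_ℂ + ⟪F.coeff 1 x, y 1⟫_ℂ := by
  have hshift : shiftForward Y (inclZero Y (F.coeff 1 x)) = lp.single 2 1 (F.coeff 1 x) :=
    shiftForward_single 0 _
  rw [F.mulOperator_inclZero, hshift, inner_add_left, inner_inclZero_left, lp.inner_single_left]

/-- The column `(F(ζ), T(ζ))` is isometric for every unimodular `ζ`, that is,
`F(ζ)* F(ζ) = I - T(ζ)* T(ζ)`. -/
def IsDefectFactor (T : LinearPencil X X) (F : LinearPencil X Y) : Prop :=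
  ∀ (ζ : Circle) (x y : X),
    ⟪F.eval ζ x, F.eval ζ y⟫_ℂ + ⟪T.eval ζ x, T.eval ζ y⟫_ℂ = ⟪x, y⟫_ℂ

theorem isOuterFactor_iff [CompleteSpace X] [CompleteSpace Y] {T : LinearPencil X X}
    {F : LinearPencil X Y} : IsOuterFactor T F ↔ IsOuter F.eval ∧ IsDefectFactor T F := by
  refine and_congr_right fun _ => forall_congr' fun ζ => ?_
  rw [ContinuousLinearMap.ext_iff, forall_comm]
  refine forall_congr' fun y => ?_
  rw [ext_iff_inner_left ℂ]
  refine forall_congr' fun x => ?_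
  simp [inner_sub_right, ContinuousLinearMap.adjoint_inner_right, eq_sub_iff_add_eq]

theorem IsDefectFactor.norm_sq_add_norm_sq {T : LinearPencil X X} {F : LinearPencil X Y}
    (h : IsDefectFactor T F) (ζ : Circle) (x : X) :
    ‖F.eval ζ x‖ ^ 2 + ‖T.eval ζ x‖ ^ 2 = ‖x‖ ^ 2 := by
  have hinner := h ζ x x
  simp only [inner_self_eq_norm_sq_to_K] at hinner
  exact_mod_cast hinner

theorem IsDefectFactor.norm_eval_le_one {T : LinearPencil X X} {F : LinearPencil X Y}
    (h : IsDefectFactor T F) (ζ : Circle) : ‖F.eval ζ‖ ≤ 1 := by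
  refine ContinuousLinearMap.opNorm_le_bound _ zero_le_one fun x => ?_
  nlinarith [h.norm_sq_add_norm_sq ζ x, norm_nonneg x, norm_nonneg (F.eval ζ x),
    sq_nonneg ‖T.eval ζ x‖]

-- Only `x = (h, 0, …)` with `y = (h', 0, …)` and `y = (0, h', 0, …)` are needed: they give the
-- coefficients of `1` and `ζ̄` in `F(ζ)* F(ζ) + T(ζ)* T(ζ)`.
theorem isDefectFactor_of_inner_mulOperator {T : LinearPencil X X} {F : LinearPencil X Y}
    (h : ∀ x y, ⟪F.mulOperator x, F.mulOperator y⟫_ℂ + ⟪T.mulOperator x, T.mulOperator y⟫_ℂ =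
      ⟪x, y⟫_ℂ) : IsDefectFactor T F := by
  have hdiag (x y : X) : ⟪F.coeff 0 x, F.coeff 0 y⟫_ℂ + ⟪F.coeff 1 x, F.coeff 1 y⟫_ℂ +
      (⟪T.coeff 0 x, T.coeff 0 y⟫_ℂ + ⟪T.coeff 1 x, T.coeff 1 y⟫_ℂ) = ⟪x, y⟫_ℂ := by
    simpa [inner_mulOperator_inclZero, inner_inclZero_left, LinearPencil.mulOperator_apply_zero,
      LinearPencil.mulOperator_apply_one, inclZero_succ _ 0] using h (inclZero X x) (inclZero X y)
  have hoff (x y : X) : ⟪F.coeff 1 x, F.coeff 0 y⟫_ℂ + ⟪T.coeff 1 x, T.coeff 0 y⟫_ℂ = 0 := by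
    simpa [inner_mulOperator_inclZero, inner_inclZero_left, LinearPencil.mulOperator_apply_zero,
      LinearPencil.mulOperator_apply_one, shiftForward_succ _ 0]
      using h (inclZero X x) (shiftForward X (inclZero X y))
  intro ζ x y
  have hoff' := congrArg (starRingEnd ℂ) (hoff y x)
  simp only [map_add, map_zero, inner_conj_symm] at hoff'
  simp only [LinearPencil.eval_apply, inner_add_left, inner_add_right, inner_smul_left,
    inner_smul_right]
  linear_combination hdiag x y + starRingEnd ℂ ζ * hoff x y + (ζ : ℂ) * hoff' +
    (⟪F.coeff 1 x, F.coeff 1 y⟫_ℂ + ⟪T.coeff 1 x, T.coeff 1 y⟫_ℂ) * coe_circle_mul_conj ζ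

theorem denseRange_of_comp_linearIsometry {E : Type*} {R : Type w} [NormedAddCommGroup R]
    [InnerProductSpace ℂ R] (Φ : Y →ₗᵢ[ℂ] R) {f : E → Y} (h : DenseRange (Φ ∘ f)) :
    DenseRange f := by
  intro y
  rw [Φ.isometry.isEmbedding.isInducing.closure_eq_preimage_closure_image, ← Set.range_comp]
  exact h (Φ y)

theorem exists_isOuterFactor [CompleteSpace X] {T : LinearPencil X X} (hT : T.IsContractive) :
    ∃ (Y : Type u) (_ : NormedAddCommGroup Y) (_ : InnerProductSpace ℂ Y) (_ : CompleteSpace Y)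
      (F : LinearPencil X Y), IsOuterFactor T F := by
  obtain ⟨R, _, D, hD, hinner⟩ := exists_denseRange_defectOperator <|
    norm_mulOperator_apply_le fun z hz =>
      LinearPencil.norm_eval_le_one hT (mem_ball_zero_iff.1 hz).le
  have hshift (x : SeqSum X) : ‖D (shiftForward X x)‖ = ‖D x‖ := by
    have hsq := hinner (shiftForward X x) (shiftForward X x)
    rw [T.mulOperator_shiftForward, inner_shiftForward, inner_shiftForward, ← hinner x x,
      inner_self_eq_norm_sq_to_K, inner_self_eq_norm_sq_to_K] at hsq
    exact (sq_eq_sq₀ (norm_nonneg _) (norm_nonneg _)).1 (mod_cast hsq)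
  obtain ⟨W, hW⟩ := exists_linearIsometry_of_denseRange hD (f := D ∘L shiftForward X) hshift
  have hδ (x : X) (z : R) : ⟪W (W z), D (inclZero X x)⟫_ℂ = 0 := by
    refine hD.induction_on (p := fun z => ⟪W (W z), D (inclZero X x)⟫_ℂ = 0) z
      (isClosed_eq (by fun_prop) continuous_const) fun y => ?_
    rw [hW, ContinuousLinearMap.comp_apply, hW, ContinuousLinearMap.comp_apply, hinner,
      T.mulOperator_shiftForward, T.mulOperator_shiftForward, inner_eq_zero_symm.1, zero_sub,
      inner_eq_zero_symm.1, neg_zero]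
    · simp [inner_mulOperator_inclZero, shiftForward_succ _ 0]
    · simp [inner_inclZero_left]
  obtain ⟨F, hF⟩ := exists_linearPencil_wanderingSpace W (D ∘L inclZero X) hδ
  have hΦ := wanderingIsometry_mulOperator W (fun x => (hW x).symm) hF
  have hdefect : IsDefectFactor T F := isDefectFactor_of_inner_mulOperator fun x y => by
    rw [← (wanderingIsometry W).inner_map_map, hΦ, hΦ, hinner, sub_add_cancel]
  have hdense : DenseRange F.mulOperator :=
    denseRange_of_comp_linearIsometry (wanderingIsometry W) <| by
      rwa [Function.comp_def, funext hΦ]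
  have hcontr (z : ℂ) (hz : z ∈ Metric.ball 0 1) : ‖F.eval z‖ ≤ 1 :=
    LinearPencil.norm_eval_le_one hdefect.norm_eval_le_one (mem_ball_zero_iff.1 hz).le
  exact ⟨wanderingSpace W, inferInstance, inferInstance, inferInstance, F,
    isOuterFactor_iff.2 ⟨(isOuter_eval_iff F).2 ⟨hcontr, hdense⟩, hdefect⟩⟩

end Factorization

section IsometricPencil

variable {E : Type u} [NormedAddCommGroup E] [InnerProductSpace ℂ E] {V : LinearPencil E E}

/-- A linear pencil whose values on the unit circle are isometries. -/
def LinearPencil.IsIsometric (V : LinearPencil E E) : Prop :=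
  ∀ (ζ : Circle) (x : E), ‖V.eval ζ x‖ = ‖x‖

theorem LinearPencil.IsIsometric.inner_map_map (hV : V.IsIsometric) (ζ : Circle) (x y : E) :
    ⟪V.eval ζ x, V.eval ζ y⟫_ℂ = ⟪x, y⟫_ℂ :=
  (LinearMap.norm_map_iff_inner_map_map (V.eval ζ)).1 (hV ζ) x y

theorem LinearPencil.IsIsometric.inner_coeff_zero_coeff_one (hV : V.IsIsometric) (x y : E) :
    ⟪V.coeff 0 x, V.coeff 1 y⟫_ℂ = 0 := by
  have hexpand (ζ : Circle) : ⟪V.coeff 0 x, V.coeff 0 y⟫_ℂ + ζ * ⟪V.coeff 0 x, V.coeff 1 y⟫_ℂ +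
      starRingEnd ℂ ζ * ⟪V.coeff 1 x, V.coeff 0 y⟫_ℂ + ⟪V.coeff 1 x, V.coeff 1 y⟫_ℂ = ⟪x, y⟫_ℂ := by
    rw [← hV.inner_map_map ζ x y]
    simp only [LinearPencil.eval_apply, inner_add_left, inner_add_right, inner_smul_left,
      inner_smul_right]
    linear_combination (-⟪V.coeff 1 x, V.coeff 1 y⟫_ℂ) * coe_circle_mul_conj ζ
  have hone := hexpand 1
  have hneg := hexpand (-1)
  have hI := hexpand ⟨Complex.I, by simp [Submonoid.unitSphere]⟩
  have hnegI := hexpand ⟨-Complex.I, by simp [Submonoid.unitSphere]⟩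
  simp only [Circle.coe_one, Circle.coe_neg, map_one, map_neg, Complex.conj_I]
    at hone hneg hI hnegI
  linear_combination (hone - hneg) / 4 - Complex.I * (hI - hnegI) / 4 +
    (⟪V.coeff 0 x, V.coeff 1 y⟫_ℂ - ⟪V.coeff 1 x, V.coeff 0 y⟫_ℂ) / 2 * Complex.I_mul_I

theorem eval_mem_rangeSpan (V : LinearPencil E E) (ζ : Circle) (x : E) :
    V.eval ζ x ∈ rangeSpan V :=
  Submodule.le_topologicalClosure _ (Submodule.mem_iSup_of_mem ζ (LinearMap.mem_range_self _ x))

theorem topologicalClosure_range_coeff_le_rangeSpan (V : LinearPencil E E) (i : Fin 2) :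
    (V.coeff i).range.topologicalClosure ≤ rangeSpan V := by
  refine Submodule.topologicalClosure_minimal _ ?_ (Submodule.isClosed_topologicalClosure _)
  rintro _ ⟨x, rfl⟩
  exact V.coeff_mem_of_forall_eval_mem _ (fun ζ => eval_mem_rangeSpan V ζ x) i

theorem eqOn_rangeSpan {G : Type*} [NormedAddCommGroup G] [InnerProductSpace ℂ G]
    {A B : E →L[ℂ] G} (h : ∀ (ζ : Circle) (x : E), A (V.eval ζ x) = B (V.eval ζ x)) :
    Set.EqOn A B (rangeSpan V) := by
  have hle : rangeSpan V ≤ A.eqLocus B := by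
    refine Submodule.topologicalClosure_minimal _ (iSup_le fun ζ => ?_)
      (isClosed_eq A.continuous B.continuous)
    rintro _ ⟨x, rfl⟩
    exact h ζ x
  exact fun x hx => hle hx

variable [CompleteSpace E]

theorem diagPencil_eval_mem_rangeSpan (V : LinearPencil E E) (z : ℂ) (x : E) :
    (diagPencil V).eval z x ∈ rangeSpan V := by
  have hcoeff (i : Fin 2) : (diagPencil V).coeff i x ∈ rangeSpan V :=
    topologicalClosure_range_coeff_le_rangeSpan V i (Submodule.starProjection_apply_mem _ _)
  rw [LinearPencil.eval_apply]
  exact add_mem (hcoeff 0) (Submodule.smul_mem _ z (hcoeff 1))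

theorem inner_diagPencil_eval_left (V : LinearPencil E E) (z : ℂ) (x y : E) :
    ⟪(diagPencil V).eval z x, y⟫_ℂ = ⟪x, (diagPencil V).eval (starRingEnd ℂ z) y⟫_ℂ := by
  simp [LinearPencil.eval_apply, diagPencil, Submodule.inner_starProjection_left_eq_right,
    mul_comm]

namespace LinearPencil.IsIsometric

theorem diagPencil_eval_eval (hV : V.IsIsometric) (z w : ℂ) (x : E) :
    (diagPencil V).eval z (V.eval w x) = V.eval (z * w) x := by
  have hself (i : Fin 2) : (diagPencil V).coeff i (V.coeff i x) = V.coeff i x :=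
    Submodule.starProjection_eq_self_iff.2
      (Submodule.le_topologicalClosure _ (LinearMap.mem_range_self _ x))
  have hzero {i j : Fin 2} (hij : ∀ y, ⟪V.coeff i y, V.coeff j x⟫_ℂ = 0) :
      (diagPencil V).coeff i (V.coeff j x) = 0 := by
    refine (Submodule.starProjection_apply_eq_zero_iff _).2 ?_
    rw [Submodule.orthogonal_closure]
    rintro _ ⟨y, rfl⟩
    exact hij y
  have hzero_one := hzero fun y => hV.inner_coeff_zero_coeff_one y x
  have hone_zero := hzero fun y => inner_eq_zero_symm.1 (hV.inner_coeff_zero_coeff_one x y)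
  simp only [eval_apply, map_add, map_smul, hself, hzero_one, hone_zero, smul_zero, add_zero,
    zero_add, smul_smul, mul_comm w z]

theorem diagPencil_eval_one (hV : V.IsIsometric) {x : E} (hx : x ∈ rangeSpan V) :
    (diagPencil V).eval 1 x = x :=
  eqOn_rangeSpan (B := .id ℂ E) (fun ζ y => by simp [hV.diagPencil_eval_eval]) hx

theorem diagPencil_eval_diagPencil_eval (hV : V.IsIsometric) (z w : ℂ) {x : E}
    (hx : x ∈ rangeSpan V) :
    (diagPencil V).eval z ((diagPencil V).eval w x) = (diagPencil V).eval (z * w) x :=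
  eqOn_rangeSpan (A := (diagPencil V).eval z ∘L (diagPencil V).eval w)
    (fun ζ y => by simp [hV.diagPencil_eval_eval, mul_assoc]) hx

theorem inner_diagPencil_eval (hV : V.IsIsometric) (ζ : Circle) (x : E) {y : E}
    (hy : y ∈ rangeSpan V) :
    ⟪(diagPencil V).eval ζ x, (diagPencil V).eval ζ y⟫_ℂ = ⟪x, y⟫_ℂ := by
  rw [inner_diagPencil_eval_left, hV.diagPencil_eval_diagPencil_eval _ _ hy, mul_comm,
    coe_circle_mul_conj, hV.diagPencil_eval_one hy]

theorem diagPencil_eval_eval_one (hV : V.IsIsometric) (ζ : Circle) (x : E) :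
    (diagPencil V).eval ζ (V.eval (1 : Circle) x) = V.eval ζ x := by
  rw [hV.diagPencil_eval_eval, Circle.coe_one, mul_one]

theorem inner_eval_defectPencil_eval (hV : V.IsIsometric) (ζ : Circle) (x : E)
    (u : DefectSpace V) : ⟪V.eval ζ x, (defectPencil V).eval ζ u⟫_ℂ = 0 := by
  rw [defectPencil_eval, inner_add_right, u.snd.2 _ (eval_mem_rangeSpan V ζ x), add_zero,
    ← hV.diagPencil_eval_eval_one, hV.inner_diagPencil_eval ζ _ u.fst.2.1]
  exact u.fst.2.2 _ (LinearMap.mem_range_self _ x)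

theorem norm_defectPencil_eval (hV : V.IsIsometric) (ζ : Circle) (u : DefectSpace V) :
    ‖(defectPencil V).eval ζ u‖ = ‖u‖ := by
  have horth : ⟪(diagPencil V).eval ζ (u.fst : E), (u.snd : E)⟫_ℂ = 0 :=
    u.snd.2 _ (diagPencil_eval_mem_rangeSpan V ζ _)
  have hnorm : ‖(diagPencil V).eval ζ (u.fst : E)‖ = ‖u.fst‖ := by
    rw [@norm_eq_sqrt_re_inner ℂ, hV.inner_diagPencil_eval ζ _ u.fst.2.1,
      ← @norm_eq_sqrt_re_inner ℂ, Submodule.coe_norm]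
  rw [← sq_eq_sq₀ (norm_nonneg _) (norm_nonneg _), WithLp.prod_norm_sq_eq_of_L2,
    defectPencil_eval, sq, norm_add_sq_eq_norm_sq_add_norm_sq_of_inner_eq_zero _ _ horth, hnorm,
    Submodule.coe_norm, ← Submodule.coe_norm u.snd, sq, sq]

theorem exists_defectPencil_eval_eq (hV : V.IsIsometric) (ζ : Circle) {w : E}
    (hw : w ∈ (V.eval ζ).rangeᗮ) : ∃ u, (defectPencil V).eval ζ u = w := by
  have : CompleteSpace (rangeSpan V) :=
    (Submodule.isClosed_topologicalClosure _).completeSpace_coe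
  obtain ⟨a, ha, l, hl, rfl⟩ := (rangeSpan V).exists_add_mem_mem_orthogonal w
  have hk : (diagPencil V).eval (starRingEnd ℂ ζ) a ∈ spaceK V 1 := by
    refine ⟨diagPencil_eval_mem_rangeSpan V _ a, ?_⟩
    rintro _ ⟨x, rfl⟩
    have hsum : ⟪V.eval ζ x, a + l⟫_ℂ = 0 := hw _ (LinearMap.mem_range_self _ x)
    rw [inner_add_right, hl _ (eval_mem_rangeSpan V ζ x), add_zero] at hsum
    change ⟪V.eval (1 : Circle) x, _⟫_ℂ = 0
    rwa [← inner_diagPencil_eval_left, hV.diagPencil_eval_eval_one]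
  refine ⟨WithLp.toLp 2 (⟨_, hk⟩, ⟨l, hl⟩), ?_⟩
  rw [defectPencil_eval]
  change (diagPencil V).eval ζ ((diagPencil V).eval (starRingEnd ℂ ζ) a) + l = a + l
  rw [hV.diagPencil_eval_diagPencil_eval _ _ ha, coe_circle_mul_conj, hV.diagPencil_eval_one ha]

end LinearPencil.IsIsometric

end IsometricPencil

theorem withLp_prod_ext {A B : Type*} {x y : WithLp 2 (A × B)} (hfst : x.fst = y.fst)
    (hsnd : x.snd = y.snd) : x = y :=
  WithLp.ofLp_injective 2 (Prod.ext hfst hsnd)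

section Shift

variable {X : Type u} [NormedAddCommGroup X] [InnerProductSpace ℂ X]

theorem shiftForward_shiftBackward_add_inclZero (x : SeqSum X) :
    shiftForward X (shiftBackward X x) + inclZero X (x 0) = x := by
  ext n
  cases n <;> simp

theorem shiftBackward_shiftForward_add_inclZero (x : SeqSum X) (x₀ : X) :
    shiftBackward X (shiftForward X x + inclZero X x₀) = x := by
  ext n
  simp

theorem norm_sq_eq_add_norm_sq_shiftBackward (x : SeqSum X) :
    ‖x‖ ^ 2 = ‖x 0‖ ^ 2 + ‖shiftBackward X x‖ ^ 2 := by
  simp only [norm_sq_tsum, (summable_sq x).tsum_eq_zero_add, shiftBackward_apply]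

theorem inner_shiftForward_left (x y : SeqSum X) :
    ⟪shiftForward X x, y⟫_ℂ = ⟪x, shiftBackward X y⟫_ℂ := by
  have hzero : ⟪shiftForward X x, inclZero X (y 0)⟫_ℂ = 0 := by
    rw [inner_eq_zero_symm, inner_inclZero_left, shiftForward_zero, inner_zero_right]
  rw [← inner_shiftForward x, ← add_zero ⟪_, shiftForward X (shiftBackward X y)⟫_ℂ, ← hzero,
    ← inner_add_right, shiftForward_shiftBackward_add_inclZero]

end Shift

theorem LinearPencil.eval_mk_comp {E : Type u} {F : Type v} {G : Type w}
    [NormedAddCommGroup E] [InnerProductSpace ℂ E] [NormedAddCommGroup F] [InnerProductSpace ℂ F]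
    [NormedAddCommGroup G] [InnerProductSpace ℂ G] (L : F →L[ℂ] G) (A : LinearPencil E F) (z : ℂ)
    (x : E) : (LinearPencil.mk fun i => L ∘L A.coeff i).eval z x = L (A.eval z x) := by
  simp [eval_apply]

section UnitaryDilation

variable {H : Type u} {Y : Type v} [NormedAddCommGroup H] [InnerProductSpace ℂ H]
  [NormedAddCommGroup Y] [InnerProductSpace ℂ Y]

theorem isomDilation_eval (T : LinearPencil H H) (F : LinearPencil H Y) (z : ℂ) (x : KPlus Y H) :
    (isomDilation T F).eval z x =
      WithLp.toLp 2 (shiftForward Y x.fst + inclZero Y (F.eval z x.snd), T.eval z x.snd) := by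
  refine withLp_prod_ext ?_ ?_ <;>
    simp [isomDilation, LinearPencil.eval_apply, intoSum, projH, add_assoc]

theorem blockPencil_eval {U : Type w} [NormedAddCommGroup U] [InnerProductSpace ℂ U]
    (T : LinearPencil H H) (F : LinearPencil H Y) (A : LinearPencil U Y) (B : LinearPencil U H)
    (z : ℂ) (k : KFull Y H U) :
    (blockPencil T F A B).eval z k = WithLp.toLp 2 (WithLp.toLp 2
      (shiftForward Y k.fst.fst + inclZero Y (F.eval z k.fst.snd + A.eval z (k.snd 0)),
        T.eval z k.fst.snd + B.eval z (k.snd 0)), shiftBackward U k.snd) := by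
  refine withLp_prod_ext (withLp_prod_ext ?_ (blockPencil_row_H T F A B z k)) ?_ <;> ext n : 2
  · cases n <;> simp [blockPencil_row_Y_zero, blockPencil_row_Y_succ]
  · exact blockPencil_row_U T F A B z k n

theorem mem_unitary_of_norm_map_of_surjective [CompleteSpace H] {A : H →L[ℂ] H}
    (hnorm : ∀ x, ‖A x‖ = ‖x‖) (hsurj : Function.Surjective A) : A ∈ unitary (H →L[ℂ] H) :=
  (Unitary.linearIsometryEquiv.symm
    (LinearIsometryEquiv.ofSurjective ⟨A.toLinearMap, hnorm⟩ hsurj)).2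

namespace IsDefectFactor

variable {T : LinearPencil H H} {F : LinearPencil H Y}

theorem isIsometric_isomDilation (hF : IsDefectFactor T F) : (isomDilation T F).IsIsometric := by
  intro ζ x
  rw [← sq_eq_sq₀ (norm_nonneg _) (norm_nonneg _), WithLp.prod_norm_sq_eq_of_L2,
    WithLp.prod_norm_sq_eq_of_L2 x, isomDilation_eval, norm_sq_eq_add_norm_sq_shiftBackward]
  simp only [WithLp.toLp_fst, WithLp.toLp_snd, shiftBackward_shiftForward_add_inclZero,
    lp.coeFn_add, Pi.add_apply, shiftForward_zero, inclZero_zero, zero_add]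
  linarith [hF.norm_sq_add_norm_sq ζ x.snd]

variable [CompleteSpace H] [CompleteSpace Y]

theorem pencilQ_eval_fst (hF : IsDefectFactor T F) (ζ : Circle)
    (u : DefectSpace (isomDilation T F)) :
    inclZero Y (((pencilQ T F).eval ζ u).fst 0) = ((pencilQ T F).eval ζ u).fst := by
  set y := ((pencilQ T F).eval ζ u).fst
  have hV : (isomDilation T F).eval ζ (WithLp.toLp 2 (shiftBackward Y y, 0)) =
      WithLp.toLp 2 (shiftForward Y (shiftBackward Y y), 0) := by
    simp [isomDilation_eval]
  have horth : ⟪shiftForward Y (shiftBackward Y y), y⟫_ℂ = 0 := by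
    have h : ⟪(isomDilation T F).eval ζ _, (pencilQ T F).eval ζ u⟫_ℂ = 0 :=
      hF.isIsometric_isomDilation.inner_eval_defectPencil_eval ζ
        (WithLp.toLp 2 (shiftBackward Y y, 0)) u
    rw [hV, WithLp.prod_inner_apply] at h
    simpa using h
  rw [inner_shiftForward_left, inner_self_eq_zero] at horth
  simpa [horth] using shiftForward_shiftBackward_add_inclZero y

theorem unitaryDilation_eval (hF : IsDefectFactor T F) (ζ : Circle) (k : DilationSpace T F) :
    (unitaryDilation T F).eval ζ k = WithLp.toLp 2
      ((isomDilation T F).eval ζ k.fst + (pencilQ T F).eval ζ (k.snd 0),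
        shiftBackward _ k.snd) := by
  have hY : (LinearPencil.mk fun i => projY Y H ∘L (pencilQ T F).coeff i).eval ζ (k.snd 0) =
      ((pencilQ T F).eval ζ (k.snd 0)).fst 0 := LinearPencil.eval_mk_comp _ _ _ _
  have hH : (LinearPencil.mk fun i => projH Y H ∘L (pencilQ T F).coeff i).eval ζ (k.snd 0) =
      ((pencilQ T F).eval ζ (k.snd 0)).snd := LinearPencil.eval_mk_comp _ _ _ _
  refine withLp_prod_ext (withLp_prod_ext ?_ ?_) ?_ <;>
    simp only [unitaryDilation, blockPencil_eval, isomDilation_eval, hY, hH, WithLp.toLp_fst,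
      WithLp.toLp_snd, WithLp.add_fst, WithLp.add_snd]
  rw [map_add, hF.pencilQ_eval_fst, add_assoc]

theorem norm_unitaryDilation_eval (hF : IsDefectFactor T F) (ζ : Circle) (k : DilationSpace T F) :
    ‖(unitaryDilation T F).eval ζ k‖ = ‖k‖ := by
  have hV := hF.isIsometric_isomDilation
  have hpyth : ‖(isomDilation T F).eval ζ k.fst + (pencilQ T F).eval ζ (k.snd 0)‖ ^ 2 =
      ‖k.fst‖ ^ 2 + ‖k.snd 0‖ ^ 2 := by
    rw [pencilQ, sq, norm_add_sq_eq_norm_sq_add_norm_sq_of_inner_eq_zero _ _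
      (hV.inner_eval_defectPencil_eval ζ _ _), hV ζ, hV.norm_defectPencil_eval, sq, sq]
  rw [← sq_eq_sq₀ (norm_nonneg _) (norm_nonneg _), WithLp.prod_norm_sq_eq_of_L2,
    WithLp.prod_norm_sq_eq_of_L2 k, norm_sq_eq_add_norm_sq_shiftBackward k.snd,
    hF.unitaryDilation_eval, ← add_assoc, ← hpyth]
  rfl

theorem surjective_unitaryDilation_eval (hF : IsDefectFactor T F) (ζ : Circle) :
    Function.Surjective ((unitaryDilation T F).eval ζ) := by
  intro w
  have hV := hF.isIsometric_isomDilation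
  have : CompleteSpace ((isomDilation T F).eval ζ).range :=
    (AddMonoidHomClass.isometry_of_norm _ (hV ζ)).isClosedEmbedding.isClosed_range.completeSpace_coe
  obtain ⟨_, ⟨x, rfl⟩, q, hq, hw⟩ :=
    ((isomDilation T F).eval ζ).range.exists_add_mem_mem_orthogonal w.fst
  obtain ⟨u, rfl⟩ := hV.exists_defectPencil_eval_eq ζ hq
  refine ⟨WithLp.toLp 2 (x, shiftForward _ w.snd + inclZero _ u), ?_⟩
  rw [hF.unitaryDilation_eval]
  refine withLp_prod_ext ?_ (shiftBackward_shiftForward_add_inclZero _ _)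
  simpa [pencilQ] using hw.symm

theorem isUnitary_unitaryDilation (hF : IsDefectFactor T F) : (unitaryDilation T F).IsUnitary :=
  fun ζ => mem_unitary_of_norm_map_of_surjective (hF.norm_unitaryDilation_eval ζ)
    (hF.surjective_unitaryDilation_eval ζ)

end IsDefectFactor

end UnitaryDilation

section Compression

variable {H : Type u} {Y : Type v} {U : Type w}
  [NormedAddCommGroup H] [InnerProductSpace ℂ H]
  [NormedAddCommGroup Y] [InnerProductSpace ℂ Y]
  [NormedAddCommGroup U] [InnerProductSpace ℂ U]

/-- `A` is block upper triangular for the decomposition `(⨁ Y) ⊕ H ⊕ (⨁ U)`, with diagonal entry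
`S` on `H`. Such pairs are closed under products, which is why all words in the coefficients of a
block pencil compress to the corresponding words on `H`. -/
def HasDiagonalBlock (A : KFull Y H U →L[ℂ] KFull Y H U) (S : H →L[ℂ] H) : Prop :=
  ∀ k, k.snd = 0 → (A k).snd = 0 ∧ (A k).fst.snd = S k.fst.snd

namespace HasDiagonalBlock

variable {A B : KFull Y H U →L[ℂ] KFull Y H U} {R S : H →L[ℂ] H}

theorem one : HasDiagonalBlock (1 : KFull Y H U →L[ℂ] KFull Y H U) 1 :=
  fun _ hk => ⟨hk, rfl⟩

theorem mul (hA : HasDiagonalBlock A S) (hB : HasDiagonalBlock B R) :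
    HasDiagonalBlock (A * B) (S * R) := fun k hk =>
  have ⟨hU, hH⟩ := hB k hk
  have ⟨hU', hH'⟩ := hA _ hU
  ⟨hU', hH'.trans (congrArg S hH)⟩

theorem pow (hA : HasDiagonalBlock A S) (n : ℕ) : HasDiagonalBlock (A ^ n) (S ^ n) := by
  induction n with
  | zero => exact one
  | succ n ih => simpa only [pow_succ] using ih.mul hA

end HasDiagonalBlock

theorem hasDiagonalBlock_coeff (T : LinearPencil H H) (F : LinearPencil H Y)
    (A : LinearPencil U Y) (B : LinearPencil U H) (i : Fin 2) :
    HasDiagonalBlock ((blockPencil T F A B).coeff i) (T.coeff i) := fun k hk => by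
  fin_cases i <;> simp [blockPencil, intoSum, compH, compU, hk]

theorem hasDiagonalBlock_eval (T : LinearPencil H H) (F : LinearPencil H Y)
    (A : LinearPencil U Y) (B : LinearPencil U H) (z : ℂ) :
    HasDiagonalBlock ((blockPencil T F A B).eval z) (T.eval z) := fun k hk => by
  simp [blockPencil_eval, hk]

variable [CompleteSpace H] [CompleteSpace Y] [CompleteSpace U]

theorem adjoint_embH_apply (k : KFull Y H U) :
    ContinuousLinearMap.adjoint (embH Y H U).toContinuousLinearMap k = k.fst.snd := by
  refine ext_inner_left ℂ fun h => ?_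
  rw [ContinuousLinearMap.adjoint_inner_right]
  change ⟪WithLp.toLp 2 (WithLp.toLp 2 ((0 : SeqSum Y), h), (0 : SeqSum U)), k⟫_ℂ = _
  simp [WithLp.prod_inner_apply]

theorem HasDiagonalBlock.eq_compression {A : KFull Y H U →L[ℂ] KFull Y H U} {S : H →L[ℂ] H}
    (hA : HasDiagonalBlock A S) : S = compression (embH Y H U) A := by
  ext h
  exact ((adjoint_embH_apply _).trans (hA (embH Y H U h) rfl).2).symm

theorem isUniformDilation_blockPencil (T : LinearPencil H H) (F : LinearPencil H Y)
    (A : LinearPencil U Y) (B : LinearPencil U H) :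
    IsUniformDilation (embH Y H U) T (blockPencil T F A B) := by
  refine ⟨fun ζ n => ((hasDiagonalBlock_eval T F A B ζ).pow n).eq_compression, fun j =>
    HasDiagonalBlock.eq_compression ?_⟩
  induction j with
  | nil => exact .one
  | cons i j ih => exact (hasDiagonalBlock_coeff T F A B i).mul ih

end Compression

section Reducing

variable {E : Type u} [NormedAddCommGroup E] [InnerProductSpace ℂ E] [CompleteSpace E]

/-- The subspace `M` is invariant under all `U(ζ)`, `|ζ| = 1`, and under their inverses; this is
stated without mentioning the inverses, for pencils whose values on the circle are bijective. -/
def LinearPencil.IsReducing (U : LinearPencil E E) (M : Submodule ℂ E) : Prop :=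
  ∀ (ζ : Circle) (x : E), U.eval ζ x ∈ M ↔ x ∈ M

theorem LinearPencil.IsUnitary.isIsometric {U : LinearPencil E E} (hU : U.IsUnitary) :
    U.IsIsometric :=
  fun ζ => ContinuousLinearMap.norm_map_of_mem_unitary (hU ζ)

theorem IsDilation.eval_coe {U : LinearPencil E E} {M : Submodule ℂ E} [CompleteSpace M]
    {S : LinearPencil M M} (h : IsDilation M.subtypeₗᵢ S U) (hU : U.IsIsometric)
    (hS : S.IsIsometric) (ζ : Circle) (m : M) : U.eval ζ m = S.eval ζ m := by
  have hproj : M.starProjection (U.eval ζ m) = S.eval ζ m := by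
    have hcomp := DFunLike.congr_fun (h ζ 1) m
    rw [pow_one, pow_one] at hcomp
    rw [hcomp, Submodule.starProjection_apply]
    change _ = ((ContinuousLinearMap.adjoint M.subtypeL (U.eval ζ m) : M) : E)
    rw [Submodule.adjoint_subtypeL]
  have hnorm : ‖M.starProjection (U.eval ζ m)‖ = ‖U.eval ζ m‖ := by
    rw [hproj, hU, ← Submodule.coe_norm, hS, Submodule.coe_norm]
  rw [← hproj, Submodule.starProjection_eq_self_iff.2
    ((Submodule.mem_iff_norm_starProjection M _).2 hnorm)]

theorem IsDilation.isReducing {U : LinearPencil E E} {M : Submodule ℂ E} [CompleteSpace M]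
    {S : LinearPencil M M} (h : IsDilation M.subtypeₗᵢ S U) (hU : U.IsIsometric)
    (hS : S.IsUnitary) : U.IsReducing M := by
  have heval := h.eval_coe hU hS.isIsometric
  refine fun ζ x => ⟨fun hx => ?_, fun hx => ?_⟩
  · set m : M := star (S.eval ζ) ⟨U.eval ζ x, hx⟩
    have hm : U.eval ζ m = U.eval ζ x := by
      rw [heval]
      exact congrArg Subtype.val
        (DFunLike.congr_fun (Unitary.mul_star_self_of_mem (hS ζ)) (⟨U.eval ζ x, hx⟩ : M))
    have hinj : Function.Injective (U.eval ζ) :=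
      (AddMonoidHomClass.isometry_of_norm _ (hU ζ)).injective
    exact hinj hm ▸ m.2
  · exact heval ζ ⟨x, hx⟩ ▸ (S.eval ζ ⟨x, hx⟩).2

end Reducing

theorem mem_of_forall_single_mem {X : Type u} {K : Type v} [NormedAddCommGroup X]
    [InnerProductSpace ℂ X] [NormedAddCommGroup K] [InnerProductSpace ℂ K]
    (L : SeqSum X →L[ℂ] K) {M : Submodule ℂ K} (hM : IsClosed (M : Set K))
    (h : ∀ n x, L (lp.single 2 n x) ∈ M) (a : SeqSum X) : L a ∈ M :=
  hM.mem_of_tendsto ((lp.hasSum_single (by norm_num) a).mapL L)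
    (.of_forall fun _ => M.sum_mem fun n _ => h n (a n))

section Minimal

variable {H : Type u} {Y : Type v} {U : Type w}
  [NormedAddCommGroup H] [InnerProductSpace ℂ H]
  [NormedAddCommGroup Y] [InnerProductSpace ℂ Y]
  [NormedAddCommGroup U] [InnerProductSpace ℂ U]

/-- The inclusion of `⨁ Y` into `(⨁ Y) ⊕ H ⊕ (⨁ U)`. -/
def inclY (Y : Type v) (H : Type u) (U : Type w) [NormedAddCommGroup Y] [InnerProductSpace ℂ Y]
    [NormedAddCommGroup H] [InnerProductSpace ℂ H] [NormedAddCommGroup U] [InnerProductSpace ℂ U] :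
    SeqSum Y →L[ℂ] KFull Y H U :=
  intoSum (intoSum (.id ℂ _) 0) 0

/-- The inclusion of `⨁ U` into `(⨁ Y) ⊕ H ⊕ (⨁ U)`. -/
def inclU (Y : Type v) (H : Type u) (U : Type w) [NormedAddCommGroup Y] [InnerProductSpace ℂ Y]
    [NormedAddCommGroup H] [InnerProductSpace ℂ H] [NormedAddCommGroup U] [InnerProductSpace ℂ U] :
    SeqSum U →L[ℂ] KFull Y H U :=
  intoSum 0 (.id ℂ _)

theorem toLp_eq_incl_add (a : SeqSum Y) (h : H) (b : SeqSum U) :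
    WithLp.toLp 2 (WithLp.toLp 2 (a, h), b) = inclY Y H U a + embH Y H U h + inclU Y H U b := by
  refine withLp_prod_ext (withLp_prod_ext ?_ ?_) ?_ <;> simp [inclY, inclU, embH, intoSum]

variable {T : LinearPencil H H} {F : LinearPencil H Y} {A : LinearPencil U Y}
  {B : LinearPencil U H}

theorem blockPencil_eval_inclY (z : ℂ) (a : SeqSum Y) :
    (blockPencil T F A B).eval z (inclY Y H U a) = inclY Y H U (shiftForward Y a) := by
  simp [blockPencil_eval, inclY, intoSum]

theorem blockPencil_eval_embH (z : ℂ) (h : H) :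
    (blockPencil T F A B).eval z (embH Y H U h) =
      inclY Y H U (inclZero Y (F.eval z h)) + embH Y H U (T.eval z h) := by
  rw [blockPencil_eval]
  refine withLp_prod_ext (withLp_prod_ext ?_ ?_) ?_ <;> simp [inclY, embH, intoSum]

theorem blockPencil_eval_inclU (z : ℂ) (b : SeqSum U) :
    (blockPencil T F A B).eval z (inclU Y H U b) = inclY Y H U (inclZero Y (A.eval z (b 0))) +
      embH Y H U (B.eval z (b 0)) + inclU Y H U (shiftBackward U b) := by
  rw [← toLp_eq_incl_add, blockPencil_eval]
  simp [inclU, intoSum]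

variable {M : Submodule ℂ (KFull Y H U)}

theorem inclY_mem_of_isReducing (hd : DenseRange (F.coeff 0))
    (hM : IsClosed (M : Set (KFull Y H U))) (hU : (blockPencil T F A B).IsReducing M)
    (hH : ∀ h, embH Y H U h ∈ M) (a : SeqSum Y) : inclY Y H U a ∈ M := by
  have hF (h : H) (ζ : Circle) : inclY Y H U (inclZero Y (F.eval ζ h)) ∈ M := by
    have := (hU ζ _).2 (hH h)
    rwa [blockPencil_eval_embH, M.add_mem_iff_left (hH _)] at this
  have hzero (y : Y) : inclY Y H U (inclZero Y y) ∈ M :=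
    hd.induction_on (p := fun y => inclY Y H U (inclZero Y y) ∈ M) y
      (hM.preimage (inclY Y H U ∘L inclZero Y).continuous) fun h =>
        F.coeff_mem_of_forall_eval_mem (M.comap (inclY Y H U ∘L inclZero Y).toLinearMap) (hF h) 0
  refine mem_of_forall_single_mem (inclY Y H U) hM (fun n => ?_) a
  induction n with
  | zero => exact hzero
  | succ n ih =>
    intro y
    rw [← shiftForward_single, ← blockPencil_eval_inclY (T := T) (F := F) (A := A) (B := B)
      (1 : Circle)]
    exact (hU 1 _).2 (ih y)

theorem inclU_mem_of_isReducing (hM : IsClosed (M : Set (KFull Y H U)))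
    (hU : (blockPencil T F A B).IsReducing M) (hY : ∀ a, inclY Y H U a ∈ M)
    (hH : ∀ h, embH Y H U h ∈ M) (b : SeqSum U) : inclU Y H U b ∈ M := by
  have hshift (b : SeqSum U) : inclU Y H U (shiftBackward U b) ∈ M ↔ inclU Y H U b ∈ M := by
    rw [← hU 1 (inclU Y H U b), blockPencil_eval_inclU,
      M.add_mem_iff_right (add_mem (hY _) (hH _))]
  refine mem_of_forall_single_mem (inclU Y H U) hM (fun n => ?_) b
  induction n with
  | zero =>
    intro u
    have : shiftBackward U (lp.single 2 0 u) = 0 := by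
      ext n
      simp
    rw [← hshift, this, map_zero]
    exact M.zero_mem
  | succ n ih =>
    intro u
    have : shiftBackward U (lp.single 2 (n + 1) u) = lp.single 2 n u := by
      rw [← shiftForward_single]
      ext m
      simp
    rw [← hshift, this]
    exact ih u

theorem eq_top_of_isReducing_blockPencil (hd : DenseRange (F.coeff 0))
    (hM : IsClosed (M : Set (KFull Y H U))) (hU : (blockPencil T F A B).IsReducing M)
    (hH : ∀ h, embH Y H U h ∈ M) : M = ⊤ := by
  have hY := inclY_mem_of_isReducing hd hM hU hH
  refine (Submodule.eq_top_iff').2 fun k => ?_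
  have hk : k = inclY Y H U k.fst.fst + embH Y H U k.fst.snd + inclU Y H U k.snd :=
    toLp_eq_incl_add _ _ _
  rw [hk]
  exact add_mem (add_mem (hY _) (hH _)) (inclU_mem_of_isReducing hM hU hY hH _)

end Minimal

section Main

variable {H : Type u} {Y : Type v} [NormedAddCommGroup H] [InnerProductSpace ℂ H] [CompleteSpace H]
  [NormedAddCommGroup Y] [InnerProductSpace ℂ Y] [CompleteSpace Y]
  {T : LinearPencil H H} {F : LinearPencil H Y}

theorem IsDefectFactor.eq_top_of_isDilation_subtype (hF : IsDefectFactor T F)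
    (hd : DenseRange (F.coeff 0)) (M : Submodule ℂ (DilationSpace T F)) [CompleteSpace M]
    (hH : ∀ h, embH Y H _ h ∈ M) {S : LinearPencil M M} (hS : S.IsUnitary)
    (h : IsDilation M.subtypeₗᵢ S (unitaryDilation T F)) : M = ⊤ :=
  eq_top_of_isReducing_blockPencil hd (completeSpace_coe_iff_isComplete.1 ‹_›).isClosed
    (h.isReducing hF.isUnitary_unitaryDilation.isIsometric hS) hH

theorem IsOuterFactor.isMinimalUnitaryDilation (hF : IsOuterFactor T F) (hT : T.IsContractive) :
    IsMinimalUnitaryDilation (embH Y H _) T (unitaryDilation T F) := by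
  obtain ⟨hout, hdefect⟩ := isOuterFactor_iff.1 hF
  exact ⟨⟨hT, hdefect.isUnitary_unitaryDilation, (isUniformDilation_blockPencil T F _ _).1⟩,
    fun M _ hH S hS h =>
      hdefect.eq_top_of_isDilation_subtype hout.denseRange_coeff_zero M hH hS.2.1 h⟩

theorem IsOuterFactor.isMinimalUniformUnitaryDilation (hF : IsOuterFactor T F)
    (hT : T.IsContractive) :
    IsMinimalUniformUnitaryDilation (embH Y H _) T (unitaryDilation T F) := by
  obtain ⟨hout, hdefect⟩ := isOuterFactor_iff.1 hF
  exact ⟨⟨hT, hdefect.isUnitary_unitaryDilation, isUniformDilation_blockPencil T F _ _⟩,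
    fun M _ hH S hS h =>
      hdefect.eq_top_of_isDilation_subtype hout.denseRange_coeff_zero M hH hS.2.1 h⟩

theorem IsOuterFactor.separableSpace [TopologicalSpace.SeparableSpace H]
    (hF : IsOuterFactor T F) : TopologicalSpace.SeparableSpace Y :=
  hF.1.denseRange_coeff_zero.separableSpace (F.coeff 0).continuous

end Main

end PencilDilation

end

theorem mainTheorem3_general {H : Type u} [NormedAddCommGroup H] [InnerProductSpace ℂ H]
    [CompleteSpace H] (T : PencilDilation.LinearPencil H H) (hT : T.IsContractive) :
    (∃ (Y : Type u) (_ : NormedAddCommGroup Y) (_ : InnerProductSpace ℂ Y) (_ : CompleteSpace Y)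
        (F : PencilDilation.LinearPencil H Y), PencilDilation.IsOuterFactor T F) ∧
      ∀ (Y : Type v) [NormedAddCommGroup Y] [InnerProductSpace ℂ Y] [CompleteSpace Y]
        (F : PencilDilation.LinearPencil H Y),
        PencilDilation.IsOuterFactor T F →
        PencilDilation.IsMinimalUnitaryDilation
            (PencilDilation.embH Y H
              (PencilDilation.DefectSpace (PencilDilation.isomDilation T F)))
            T (PencilDilation.unitaryDilation T F) ∧
          PencilDilation.IsMinimalUniformUnitaryDilation
            (PencilDilation.embH Y H
              (PencilDilation.DefectSpace (PencilDilation.isomDilation T F)))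
            T (PencilDilation.unitaryDilation T F) :=
  ⟨PencilDilation.exists_isOuterFactor hT, fun _ _ _ _ _ hF =>
    ⟨hF.isMinimalUnitaryDilation hT, hF.isMinimalUniformUnitaryDilation hT⟩⟩

theorem mainTheorem3 {H : Type u} [NormedAddCommGroup H] [InnerProductSpace ℂ H]
    [CompleteSpace H] [TopologicalSpace.SeparableSpace H]
    (T : PencilDilation.LinearPencil H H) (hT : T.IsContractive) :
    (∃ (Y : Type u) (_ : NormedAddCommGroup Y) (_ : InnerProductSpace ℂ Y) (_ : CompleteSpace Y)
        (_ : TopologicalSpace.SeparableSpace Y) (F : PencilDilation.LinearPencil H Y),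
        PencilDilation.IsOuterFactor T F) ∧
      ∀ (Y : Type v) [NormedAddCommGroup Y] [InnerProductSpace ℂ Y] [CompleteSpace Y]
        [TopologicalSpace.SeparableSpace Y] (F : PencilDilation.LinearPencil H Y),
        PencilDilation.IsOuterFactor T F →
        PencilDilation.IsMinimalUnitaryDilation
            (PencilDilation.embH Y H
              (PencilDilation.DefectSpace (PencilDilation.isomDilation T F)))
            T (PencilDilation.unitaryDilation T F) ∧
          PencilDilation.IsMinimalUniformUnitaryDilation
            (PencilDilation.embH Y H
              (PencilDilation.DefectSpace (PencilDilation.isomDilation T F)))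
            T (PencilDilation.unitaryDilation T F) := by
  obtain ⟨⟨Y, _, _, _, F, hF⟩, hminimal⟩ := mainTheorem3_general.{u, v} T hT
  exact ⟨⟨Y, _, _, ‹_›, hF.separableSpace, F, hF⟩, fun Y _ _ _ _ => hminimal Y⟩
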